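/- **Model.** Let $\mathcal X$ and $\mathcal Y$ be two disjoint universes of size $n$ each, and fix $x_1\in\mathcal X$. An input of the four-party hidden-pointer chasing problem consists of sets $A_x,B_x\subseteq\mathcal Y$ for every $x\in\mathcal X$ and $C_y,D_y\subseteq\mathcal X$ for every $y\in\mathcal Y$, such that each $A_x\cap B_x=\{t_x\}$ and each $C_y\cap D_y=\{t_y\}$ is a singleton. Players $P_A,P_B,P_C,P_D$ receive $(A_x)_x$, $(B_x)_x$, $(C_y)_y$, $(D_y)_y$, respectively. The pointers are $z_0:=x_1$ and $z_{j+1}:=t_{z_j}$ for $j\ge 0$, so that $z_j\in\mathcal X$ for even $j$ and $z_j\in\mathcal Y$ for odd $j$. The problem $\mathrm{HPC}_k$ asks for $z_k$. The players communicate by a randomized protocol with public and private randomness. The bits are sent one after another, each visible to all players; who speaks next, and finally which player gives the answer, is determined by the public randomness and the bits sent so far; each bit, and the answer, is a function of the public randomness, the bits sent so far, and the input and private randomness of the player who gives it. The communication is partitioned into phases: in odd phases only $P_C$ and $P_D$ speak, in even phases only $P_A$ and $P_B$ speak, phase one (possibly silent) belongs to $P_C,P_D$, and a phase ends when a player of the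 other group speaks next. A protocol is a $k$-phase protocol if it uses at most $k$ phases for every input and all random choices. Its communication cost is the maximum number of bits sent over all inputs and random choices. **Theorem.** For every real $p>0$ there are a constant $c>0$ and an integer $n_0$, depending only on $p$, such that for all $n\ge n_0$, all integers $k\ge 1$ and every $x_1\in\mathcal X$: every $k$-phase randomized protocol which on every input outputs $z_k$ with probability at least $p$ has communication cost at least $$c\left(\frac{n^2}{k^2}+n\right).$$ -/

import Mathlib

/-- The four players of the hidden-pointer chasing problem. -/
inductive Player where
  | PA | PB | PC | PD
  deriving DecidableEq

instance : Fintype Player :=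
  ⟨{.PA, .PB, .PC, .PD}, fun i => by cases i <;> decide⟩

/-- The two groups of players: `P_A, P_B` and `P_C, P_D`. -/
inductive PlayerGroup where
  | AB | CD
  deriving DecidableEq

def Player.group : Player → PlayerGroup
  | .PA => .AB
  | .PB => .AB
  | .PC => .CD
  | .PD => .CD

/-- Deterministic four-party communication protocols in which player `i` sees the data `In i` and
the answer lies in `Out`. At an inner node a player, determined by the bits communicated so far,
sends one bit that depends on her own data; all bits sent are seen by all players. At a leaf one
of the players gives the answer, as a function of her own data (and of the leaf, that is, of the
communicated bits). -/
inductive Protocol (In : Player → Type*) (Out : Type*) where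
  | answer (i : Player) (g : In i → Out) : Protocol In Out
  | speak (i : Player) (bit : In i → Bool) (next : Bool → Protocol In Out) : Protocol In Out

namespace Protocol

variable {In : Player → Type*} {Out : Type*}

/-- The answer given by the protocol on the data `x`. -/
def run : Protocol In Out → (∀ i, In i) → Out
  | .answer i g, x => g (x i)
  | .speak i bit next, x => (next (bit (x i))).run x

/-- The transcript of the protocol on the data `x`: the bits sent, each with its sender. -/
def transcript : Protocol In Out → (∀ i, In i) → List (Player × Bool)
  | .answer _ _, _ => []
  | .speak i bit next, x => (i, bit (x i)) :: (next (bit (x i))).transcript x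

end Protocol

/-- The number of phases in which the players in the list (the senders, in order) speak, if the
current phase, which is counted, belongs to the group `g`. A phase lasts as long as the senders
belong to its group; the next phase belongs to the other group. -/
def phasesFrom : PlayerGroup → List Player → ℕ
  | _, [] => 1
  | g, i :: l => if i.group = g then phasesFrom g l else phasesFrom i.group l + 1

/-- The number of phases of a transcript. Odd phases belong to `P_C, P_D` and even phases to
`P_A, P_B`; phase one is counted even if `P_C` and `P_D` remain silent in it. -/
def numPhases (t : List (Player × Bool)) : ℕ :=
  phasesFrom .CD (t.map Prod.fst)

/-- Randomized four-party protocols with public and private randomness. The public randomness and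
the private random strings of the players are mutually independent. Given the public randomness,
the players run a protocol in which each sees her input and her own private randomness. -/
structure RandomizedProtocol.{u} (In : Player → Type) (Out : Type) [MeasurableSpace Out] where
  Pub : Type u
  [measurableSpacePub : MeasurableSpace Pub]
  pubLaw : MeasureTheory.Measure Pub
  [isProbabilityMeasure_pubLaw : MeasureTheory.IsProbabilityMeasure pubLaw]
  Priv : Player → Type u
  [measurableSpacePriv : ∀ i, MeasurableSpace (Priv i)]
  privLaw : ∀ i, MeasureTheory.Measure (Priv i)
  [isProbabilityMeasure_privLaw : ∀ i, MeasureTheory.IsProbabilityMeasure (privLaw i)]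
  protocol : Pub → Protocol (fun i => In i × Priv i) Out
  /-- On every input the answer is a random variable. -/
  measurable_run : ∀ x : ∀ i, In i, Measurable fun ω : Pub × (∀ i, Priv i) =>
    (protocol ω.1).run fun i => (x i, ω.2 i)

namespace RandomizedProtocol

attribute [instance] measurableSpacePub isProbabilityMeasure_pubLaw measurableSpacePriv
  isProbabilityMeasure_privLaw

variable {In : Player → Type} {Out : Type} [MeasurableSpace Out]

/-- All random choices: the public ones and the private ones of each player. -/
abbrev Coins (π : RandomizedProtocol In Out) : Type _ := π.Pub × (∀ i, π.Priv i)

/-- The joint law of all random choices. -/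
noncomputable def law (π : RandomizedProtocol In Out) : MeasureTheory.Measure π.Coins :=
  π.pubLaw.prod (MeasureTheory.Measure.pi π.privLaw)

/-- The answer on input `x` with random choices `ω`. -/
def run (π : RandomizedProtocol In Out) (x : ∀ i, In i) (ω : π.Coins) : Out :=
  (π.protocol ω.1).run fun i => (x i, ω.2 i)

/-- The transcript on input `x` with random choices `ω`. -/
def transcript (π : RandomizedProtocol In Out) (x : ∀ i, In i) (ω : π.Coins) :
    List (Player × Bool) :=
  (π.protocol ω.1).transcript fun i => (x i, ω.2 i)

end RandomizedProtocol

/-- Inputs of the hidden-pointer chasing problem over two disjoint universes `𝒳` and `𝒴` of size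
`n`, both indexed by `Fin n`: set intersection instances `(A x, B x)` over `𝒴` for `x ∈ 𝒳` and
`(C y, D y)` over `𝒳` for `y ∈ 𝒴`, each with exactly one common element. -/
structure HPCInstance (n : ℕ) where
  A : Fin n → Finset (Fin n)
  B : Fin n → Finset (Fin n)
  C : Fin n → Finset (Fin n)
  D : Fin n → Finset (Fin n)
  exists_target_AB : ∀ x, ∃ t, A x ∩ B x = {t}
  exists_target_CD : ∀ y, ∃ t, C y ∩ D y = {t}

namespace HPCInstance

variable {n : ℕ}

/-- The input of each player. -/
def input (I : HPCInstance n) : Player → Fin n → Finset (Fin n)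
  | .PA => I.A
  | .PB => I.B
  | .PC => I.C
  | .PD => I.D

/-- `fAB x` is the unique element of `A x ∩ B x`. -/
noncomputable def fAB (I : HPCInstance n) (x : Fin n) : Fin n := (I.exists_target_AB x).choose

/-- `fCD y` is the unique element of `C y ∩ D y`. -/
noncomputable def fCD (I : HPCInstance n) (y : Fin n) : Fin n := (I.exists_target_CD y).choose

/-- The pointers `z_0 = x₁`, `z_1 = fAB z_0`, `z_2 = fCD z_1`, `z_3 = fAB z_2`, …, as elements of
the disjoint union of `𝒳` (left) and `𝒴` (right). -/
noncomputable def pointer (I : HPCInstance n) (x₁ : Fin n) : ℕ → Fin n ⊕ Fin n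
  | 0 => .inl x₁
  | j + 1 => match I.pointer x₁ j with
    | .inl x => .inr (I.fAB x)
    | .inr y => .inl (I.fCD y)

end HPCInstance

/-- Randomized protocols for hidden-pointer chasing over universes of size `n`. -/
abbrev HPCProtocol.{u} (n : ℕ) : Type (u + 1) :=
  RandomizedProtocol.{u} (fun _ => Fin n → Finset (Fin n)) (Fin n ⊕ Fin n)

namespace HPCProtocol

variable {n : ℕ}

/-- The protocol never uses more than `k` phases. -/
def IsPhase (π : HPCProtocol n) (k : ℕ) : Prop :=
  ∀ (I : HPCInstance n) (ω : π.Coins), numPhases (π.transcript I.input ω) ≤ k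

/-- The protocol never communicates more than `b` bits. -/
def CostAtMost (π : HPCProtocol n) (b : ℕ) : Prop :=
  ∀ (I : HPCInstance n) (ω : π.Coins), (π.transcript I.input ω).length ≤ b

/-- On every input, the protocol finds the pointer `z_k` with probability at least `p`. -/
def Solves (π : HPCProtocol n) (x₁ : Fin n) (k : ℕ) (p : ℝ) : Prop :=
  ∀ I : HPCInstance n, p ≤ π.law.real {ω | π.run I.input ω = I.pointer x₁ k}

end HPCProtocol

/-!
Inputs are drawn from a hard distribution in which every set intersection instance consists of a
uniform target, a random mask that splits the universe into two parts, and random subsets of the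
two parts (`Gadget`); the target is added to both subsets. Given the masks and the targets, the two
sets are independent. By averaging, the coins of the protocol are fixed, so that the inputs leading
to a given message prefix form a rectangle.

*Finding intersections.* Given the mask, a value `w` of density `p w` biases the random bits by a
total squared amount of at most `2 p² log (1 / p)` (level-one inequality), and the entropy of the
messages is at most the logarithm of their number `N`. Hence a random bit is hardly biased. By the
cut-and-paste property of rectangles in Hellinger distance, the messages then hardly notice when a
random element is added to both sets of a random instance (`expect_abs_sub_force_le`). So they
cannot tell the true target `t` from a random element `i`: both inputs look like the one in which
`t` and `i` are common elements (`expect_test_target_le`). With `M` instances over a universe of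
size `n` the error is `O(√(log N / (M n)))`.

*Chasing pointers.* The pointer `z_j` is determined by the data of the group of players that does not
speak in phase `j`. By induction on the phases, each pointer is close to uniform given the messages before
it can be computed and the pointers before it: for a nearly uniform pointer `z_j`, which depends on
the data of one group, the target at `z_j`, which depends on the data of the other group, is as hard
to predict as the target at a random point (`IsNearUniform.step`). A random point is new with
probability `1 - O(k / n)`, and its target is hidden up to an error `O(√b / n)`, where `b` is the
number of bits. Over `k` phases the error is `O(k² / n + k √b / n)`. The last answer may also depend
on the sets of one of the players who know part of the instance in question; to cover this, the best
guesses for all `n` points are added to the messages, at the price of an error `O(√(log n / n))`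
(`le_of_solves_of_isPhase`). This gives `b = Ω(n² / k²)` for `k = O(√n)`.

For larger `k` only the bound `Ω(n)` is needed. It follows from the case of one instance, embedded
into pointer chasing as a constant function followed by the identity (`le_of_solves_single`).
-/

open Finset
open scoped BigOperators

/-! ### Bias, entropy and Hellinger distance on the cube -/

/-- The sign `±1` attached to a bit. -/
def boolSign (b : Bool) : ℝ := if b then -1 else 1

section Cube

variable {Z : Type*} [Fintype Z] [DecidableEq Z]

theorem expect_exp_sum_mul_boolSign_le (l : Z → ℝ) :
    𝔼 r : Z → Bool, Real.exp (∑ c, l c * boolSign (r c)) ≤ Real.exp (∑ c, l c ^ 2 / 2) := by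
  have h1 : ∑ r : Z → Bool, Real.exp (∑ c, l c * boolSign (r c))
      = ∏ c, (2 * Real.cosh (l c)) := by
    have := Finset.prod_univ_sum (fun _ : Z => (univ : Finset Bool))
      (fun c b => Real.exp (l c * boolSign b))
    rw [Fintype.piFinset_univ] at this
    simp_rw [Real.exp_sum]
    rw [← this]
    refine prod_congr rfl fun c _ => ?_
    simp [boolSign, Real.cosh_eq]
    ring
  have hcard : (Fintype.card (Z → Bool) : ℝ) = ∏ _c : Z, (2 : ℝ) := by simp
  rw [Fintype.expect_eq_sum_div_card, h1, hcard, prod_mul_distrib, mul_div_cancel_left₀ _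
    (by positivity), Real.exp_sum]
  exact prod_le_prod (fun _ _ => (Real.cosh_pos _).le) fun c _ => Real.cosh_le_exp_half_sq _

/-- The level-one inequality: a subset of the cube of density `p` has total squared bias at most
`2 p² log (1 / p)`. -/
theorem sum_sq_expect_boolSign_le (P : (Z → Bool) → Prop) [DecidablePred P] :
    ∑ c, (𝔼 r, if P r then boolSign (r c) else 0) ^ 2 ≤
      2 * (𝔼 r, if P r then 1 else 0) * Real.negMulLog (𝔼 r, if P r then (1 : ℝ) else 0) := by
  set p : ℝ := 𝔼 r, if P r then (1 : ℝ) else 0 with hp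
  set m : Z → ℝ := fun c => 𝔼 r, if P r then boolSign (r c) else 0 with hm
  have hp0 : 0 ≤ p := expect_nonneg fun r _ => by split_ifs <;> norm_num
  rcases hp0.eq_or_lt with h0 | hpos
  · have hall : ∀ r, ¬ P r := by
      intro r hr
      have := (expect_eq_zero_iff_of_nonneg (s := (univ : Finset (Z → Bool)))
        (f := fun r => if P r then (1 : ℝ) else 0)
        (fun r _ => by positivity)).1 h0.symm r (mem_univ r)
      simp [hr] at this
    have : ∀ c, m c = 0 := fun c => by simp [hm, hall]
    simp only [hm] at this
    simp [this, ← h0]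
  -- The moment generating function is evaluated at the vector of conditional biases.
  set l : Z → ℝ := fun c => m c / p with hl
  set K : ℝ := ∑ c, l c ^ 2 / 2 - Real.log p with hK
  have h1 : 𝔼 r, (if P r then (∑ c, l c * boolSign (r c)) - K else 0)
      = ∑ c, l c * m c - p * K := by
    have : ∀ r, (if P r then (∑ c, l c * boolSign (r c)) - K else 0)
        = (∑ c, l c * (if P r then boolSign (r c) else 0)) - (if P r then (1 : ℝ) else 0) * K := by
      intro r; split_ifs <;> simp
    simp_rw [this]
    rw [expect_sub_distrib, ← expect_mul, expect_sum_comm]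
    simp_rw [← mul_expect]
    rfl
  have h2 : 𝔼 r, (if P r then (∑ c, l c * boolSign (r c)) - K else 0) ≤
      𝔼 r, (Real.exp (∑ c, l c * boolSign (r c)) * Real.exp (-K) - if P r then (1 : ℝ) else 0) := by
    refine expect_le_expect fun r _ => ?_
    rw [← Real.exp_add, ← sub_eq_add_neg]
    split_ifs
    · have := Real.add_one_le_exp ((∑ c, l c * boolSign (r c)) - K)
      linarith
    · have := Real.exp_pos ((∑ c, l c * boolSign (r c)) - K)
      linarith
  rw [expect_sub_distrib, ← expect_mul, h1, ← hp] at h2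
  have h3 : (𝔼 r : Z → Bool, Real.exp (∑ c, l c * boolSign (r c))) * Real.exp (-K) ≤ p := by
    calc _ ≤ Real.exp (∑ c, l c ^ 2 / 2) * Real.exp (-K) :=
          mul_le_mul_of_nonneg_right (expect_exp_sum_mul_boolSign_le l) (Real.exp_pos _).le
      _ = p := by rw [← Real.exp_add, hK]; ring_nf; exact Real.exp_log hpos
  have h4 : ∀ c, m c = p * l c := fun c => by rw [hl]; field_simp
  have h5 : ∑ c, l c * m c = p * ∑ c, l c ^ 2 := by
    rw [mul_sum]; exact sum_congr rfl fun c _ => by rw [h4]; ring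
  have h6 : ∑ c, l c ^ 2 ≤ K := by
    have : p * (∑ c, l c ^ 2) ≤ p * K := by linarith
    exact le_of_mul_le_mul_left this hpos
  rw [hK, ← sum_div] at h6
  have h7 : ∑ c, m c ^ 2 = p ^ 2 * ∑ c, l c ^ 2 := by
    rw [mul_sum]; exact sum_congr rfl fun c _ => by rw [h4]; ring
  change ∑ c, m c ^ 2 ≤ _
  rw [h7, Real.negMulLog]
  nlinarith [sq_nonneg p]

/-- Averages over the cube of functions of complementary sets of coordinates are independent. -/
theorem expect_mul_eq_of_dependsOn (D : Z → Bool) (u v : (Z → Bool) → ℝ)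
    (hu : ∀ r r', (∀ c, D c = true → r c = r' c) → u r = u r')
    (hv : ∀ r r', (∀ c, D c = false → r c = r' c) → v r = v r') :
    𝔼 r, u r * v r = (𝔼 r, u r) * 𝔼 r, v r := by
  let mix : (Z → Bool) → (Z → Bool) → (Z → Bool) := fun r r' c => if D c then r c else r' c
  have hinv : Function.Involutive
      (fun q : (Z → Bool) × (Z → Bool) => (mix q.1 q.2, mix q.2 q.1)) := by
    intro q
    ext c <;> simp only [mix] <;> split_ifs <;> rfl
  rw [expect_mul_expect, ← expect_product' univ univ (fun r r' => u r * v r'), univ_product_univ]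
  have h1 : 𝔼 q : (Z → Bool) × (Z → Bool), u q.1 * v q.2
      = 𝔼 q : (Z → Bool) × (Z → Bool), u q.1 * v q.1 := by
    refine Fintype.expect_equiv hinv.toPerm _ _ fun q => ?_
    change _ = u (mix q.1 q.2) * v (mix q.1 q.2)
    rw [hu q.1 (mix q.1 q.2) (fun c hc => by simp [mix, hc]),
      hv q.2 (mix q.1 q.2) (fun c hc => by simp [mix, hc])]
  rw [h1, ← univ_product_univ, expect_product' univ univ (fun r _ => u r * v r)]
  simp

theorem expect_cube_eq_update (c : Z) (g : (Z → Bool) → ℝ) :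
    𝔼 r, g r = (𝔼 r, g (Function.update r c false) + 𝔼 r, g (Function.update r c true)) / 2 := by
  have hinv : Function.Involutive (fun r : Z → Bool => Function.update r c (!r c)) := by
    intro r; ext i; by_cases h : i = c <;> simp [h, Function.update]
  have h1 : 𝔼 r, g r = 𝔼 r, g (Function.update r c (!r c)) :=
    (Fintype.expect_equiv hinv.toPerm _ _ fun r => rfl).symm
  have h2 : 𝔼 r, g r + 𝔼 r, g r
      = 𝔼 r, g (Function.update r c false) + 𝔼 r, g (Function.update r c true) := by
    nth_rw 2 [h1]
    rw [← expect_add_distrib, ← expect_add_distrib]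
    refine expect_congr rfl fun r _ => ?_
    have h3 : Function.update r c (r c) = r := Function.update_eq_self c r
    rcases h : r c with _ | _ <;> rw [h] at h3 <;> simp [h3, add_comm]
  linarith

end Cube

section CutAndPaste

variable {W : Type*} [Fintype W]

/-- The cut-and-paste property of rectangle-shaped distributions, in Hellinger form: the squared
distance of the diagonal entries is controlled by the squared distances of neighbours. -/
theorem sum_sq_diag_le (a₀ a₁ b₀ b₁ : W → ℝ)
    (h00 : ∑ w, a₀ w ^ 2 * b₀ w ^ 2 = 1) (h01 : ∑ w, a₀ w ^ 2 * b₁ w ^ 2 = 1)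
    (h10 : ∑ w, a₁ w ^ 2 * b₀ w ^ 2 = 1) (h11 : ∑ w, a₁ w ^ 2 * b₁ w ^ 2 = 1) :
    ∑ w, (a₀ w * b₀ w - a₁ w * b₁ w) ^ 2 ≤
      2 * ∑ w, (b₀ w * (a₀ w - a₁ w)) ^ 2 + 2 * ∑ w, (a₀ w * (b₀ w - b₁ w)) ^ 2 := by
  have h1 : ∑ w, (a₀ w * b₀ w - a₁ w * b₁ w) ^ 2 = ∑ w, (a₀ w * b₁ w - a₁ w * b₀ w) ^ 2 := by
    have : ∑ w, (a₀ w * b₀ w - a₁ w * b₁ w) ^ 2 - ∑ w, (a₀ w * b₁ w - a₁ w * b₀ w) ^ 2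
        = ∑ w, a₀ w ^ 2 * b₀ w ^ 2 - ∑ w, a₀ w ^ 2 * b₁ w ^ 2
          - ∑ w, a₁ w ^ 2 * b₀ w ^ 2 + ∑ w, a₁ w ^ 2 * b₁ w ^ 2 := by
      simp only [← sum_sub_distrib, ← sum_add_distrib]
      exact sum_congr rfl fun w _ => by ring
    rw [h00, h01, h10, h11] at this
    linarith
  rw [h1, mul_sum, mul_sum, ← sum_add_distrib]
  refine sum_le_sum fun w _ => ?_
  nlinarith [sq_nonneg (b₀ w * (a₀ w - a₁ w) + a₀ w * (b₀ w - b₁ w))]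

theorem sq_sqrt_sub_sqrt_le {s₀ s₁ t : ℝ} (h0 : 0 ≤ s₀) (h1 : 0 ≤ s₁) (ht : 0 ≤ t) :
    (√t * (√s₀ - √s₁)) ^ 2 ≤ 2 * (((s₀ - s₁) * t / 2) ^ 2 / ((s₀ + s₁) * t / 2)) := by
  rcases ht.eq_or_lt with rfl | ht
  · simp
  rcases (add_nonneg h0 h1).eq_or_lt with h | h
  · have e0 : s₀ = 0 := by linarith
    have e1 : s₁ = 0 := by linarith
    simp [e0, e1]
  have e : 2 * (((s₀ - s₁) * t / 2) ^ 2 / ((s₀ + s₁) * t / 2))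
      = t * ((s₀ - s₁) ^ 2 / (s₀ + s₁)) := by
    field_simp
  rw [e, mul_pow, Real.sq_sqrt ht.le]
  refine mul_le_mul_of_nonneg_left ?_ ht.le
  rw [le_div_iff₀ h]
  have x0 := Real.sqrt_nonneg s₀
  have x1 := Real.sqrt_nonneg s₁
  have y0 := Real.sq_sqrt h0
  have y1 := Real.sq_sqrt h1
  set x := √s₀
  set y := √s₁
  rw [← y0, ← y1]
  nlinarith [mul_nonneg (mul_nonneg x0 x1) (sq_nonneg (x - y))]

theorem sum_abs_le_sqrt_sum_sq_div (m p : W → ℝ) (hp : ∀ w, 0 ≤ p w)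
    (h0 : ∀ w, p w = 0 → m w = 0) (h1 : ∑ w, p w ≤ 1) :
    ∑ w, |m w| ≤ √(∑ w, m w ^ 2 / p w) := by
  refine Real.le_sqrt_of_sq_le ?_
  have h2 := sum_sq_le_sum_mul_sum_of_sq_le_mul (univ : Finset W) (r := fun w => |m w|)
    (f := fun w => m w ^ 2 / p w) (g := p) (fun w _ => div_nonneg (sq_nonneg _) (hp w))
    (fun w _ => hp w) (fun w _ => by
      by_cases h : p w = 0
      · simp [h, h0 w h]
      · rw [sq_abs]; exact le_of_eq (by field_simp))
  refine h2.trans (mul_le_of_le_one_right ?_ h1)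
  exact sum_nonneg fun w _ => div_nonneg (sq_nonneg _) (hp w)

/-- For a rectangle-shaped family of distributions `s β w * t β' w`, the distribution at `(1, 1)`
is close to the mixture of those at `(0, 0)` and `(1, 0)`, and to that of `(0, 0)` and `(0, 1)`, in
terms of the `χ²`-type distances along the two sides meeting at `(0, 0)`. -/
theorem sum_abs_sub_diag_le (s₀ s₁ t₀ t₁ : W → ℝ)
    (hs0 : ∀ w, 0 ≤ s₀ w) (hs1 : ∀ w, 0 ≤ s₁ w) (ht0 : ∀ w, 0 ≤ t₀ w) (ht1 : ∀ w, 0 ≤ t₁ w)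
    (h00 : ∑ w, s₀ w * t₀ w = 1) (h01 : ∑ w, s₀ w * t₁ w = 1)
    (h10 : ∑ w, s₁ w * t₀ w = 1) (h11 : ∑ w, s₁ w * t₁ w = 1) (V : ℝ)
    (hV : V = ∑ w, ((s₀ w - s₁ w) * t₀ w / 2) ^ 2 / ((s₀ w + s₁ w) * t₀ w / 2)
      + ∑ w, ((t₀ w - t₁ w) * s₀ w / 2) ^ 2 / ((t₀ w + t₁ w) * s₀ w / 2)) :
    ∑ w, |(s₀ w + s₁ w) * t₀ w / 2 - s₁ w * t₁ w| ≤ 5 * √V ∧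
    ∑ w, |(t₀ w + t₁ w) * s₀ w / 2 - s₁ w * t₁ w| ≤ 5 * √V := by
  set VA := ∑ w, ((s₀ w - s₁ w) * t₀ w / 2) ^ 2 / ((s₀ w + s₁ w) * t₀ w / 2) with hVA
  set VB := ∑ w, ((t₀ w - t₁ w) * s₀ w / 2) ^ 2 / ((t₀ w + t₁ w) * s₀ w / 2) with hVB
  have hA0 : 0 ≤ VA := sum_nonneg fun w _ => div_nonneg (sq_nonneg _)
    (by have := mul_nonneg (add_nonneg (hs0 w) (hs1 w)) (ht0 w); linarith)
  have hB0 : 0 ≤ VB := sum_nonneg fun w _ => div_nonneg (sq_nonneg _)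
    (by have := mul_nonneg (add_nonneg (ht0 w) (ht1 w)) (hs0 w); linarith)
  have hH : ∑ w, (√(s₀ w) * √(t₀ w) - √(s₁ w) * √(t₁ w)) ^ 2 ≤ 4 * V := by
    have h := sum_sq_diag_le (fun w => √(s₀ w)) (fun w => √(s₁ w)) (fun w => √(t₀ w))
      (fun w => √(t₁ w))
      (by simpa only [Real.sq_sqrt (hs0 _), Real.sq_sqrt (ht0 _)] using h00)
      (by simpa only [Real.sq_sqrt (hs0 _), Real.sq_sqrt (ht1 _)] using h01)
      (by simpa only [Real.sq_sqrt (hs1 _), Real.sq_sqrt (ht0 _)] using h10)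
      (by simpa only [Real.sq_sqrt (hs1 _), Real.sq_sqrt (ht1 _)] using h11)
    have hA : ∑ w, (√(t₀ w) * (√(s₀ w) - √(s₁ w))) ^ 2 ≤ 2 * VA := by
      rw [hVA, mul_sum]
      exact sum_le_sum fun w _ => sq_sqrt_sub_sqrt_le (hs0 w) (hs1 w) (ht0 w)
    have hB : ∑ w, (√(s₀ w) * (√(t₀ w) - √(t₁ w))) ^ 2 ≤ 2 * VB := by
      rw [hVB, mul_sum]
      exact sum_le_sum fun w _ => sq_sqrt_sub_sqrt_le (ht0 w) (ht1 w) (hs0 w)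
    linarith
  have hD : ∑ w, |s₀ w * t₀ w - s₁ w * t₁ w| ≤ 4 * √V := by
    have e : (4 : ℝ) * √V = √(16 * V) := by
      rw [Real.sqrt_mul (by norm_num)]
      congr 1
      rw [show (16 : ℝ) = 4 ^ 2 by norm_num, Real.sqrt_sq (by norm_num)]
    rw [e]
    refine Real.le_sqrt_of_sq_le ?_
    have h := sum_mul_sq_le_sq_mul_sq univ
      (fun w => |√(s₀ w) * √(t₀ w) - √(s₁ w) * √(t₁ w)|)
      (fun w => √(s₀ w) * √(t₀ w) + √(s₁ w) * √(t₁ w))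
    have e1 : ∀ w, |√(s₀ w) * √(t₀ w) - √(s₁ w) * √(t₁ w)|
        * (√(s₀ w) * √(t₀ w) + √(s₁ w) * √(t₁ w)) = |s₀ w * t₀ w - s₁ w * t₁ w| := by
      intro w
      rw [← abs_of_nonneg (show 0 ≤ √(s₀ w) * √(t₀ w) + √(s₁ w) * √(t₁ w) by positivity),
        ← abs_mul]
      congr 1
      have := Real.sq_sqrt (hs0 w)
      have := Real.sq_sqrt (hs1 w)
      have := Real.sq_sqrt (ht0 w)
      have := Real.sq_sqrt (ht1 w)
      calc _ = √(s₀ w) ^ 2 * √(t₀ w) ^ 2 - √(s₁ w) ^ 2 * √(t₁ w) ^ 2 := by ring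
        _ = _ := by simp only [*]
    have e2 : ∑ w, (√(s₀ w) * √(t₀ w) + √(s₁ w) * √(t₁ w)) ^ 2 ≤ 4 := by
      have : ∑ w, (√(s₀ w) * √(t₀ w) + √(s₁ w) * √(t₁ w)) ^ 2
          ≤ ∑ w, (2 * (s₀ w * t₀ w) + 2 * (s₁ w * t₁ w)) := by
        refine sum_le_sum fun w _ => ?_
        have := Real.sq_sqrt (hs0 w)
        have := Real.sq_sqrt (hs1 w)
        have := Real.sq_sqrt (ht0 w)
        have := Real.sq_sqrt (ht1 w)
        calc _ ≤ 2 * (√(s₀ w) ^ 2 * √(t₀ w) ^ 2) + 2 * (√(s₁ w) ^ 2 * √(t₁ w) ^ 2) := by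
              nlinarith [sq_nonneg (√(s₀ w) * √(t₀ w) - √(s₁ w) * √(t₁ w))]
          _ = _ := by simp only [*]
      rw [sum_add_distrib, ← mul_sum, ← mul_sum, h00, h11] at this
      linarith
    simp only [e1, sq_abs] at h
    refine h.trans ?_
    calc _ ≤ (4 * V) * 4 := mul_le_mul hH e2 (sum_nonneg fun w _ => sq_nonneg _)
          (by rw [hV]; linarith)
      _ = 16 * V := by ring
  constructor
  · have h1 : ∑ w, |(s₀ w - s₁ w) * t₀ w / 2| ≤ √VA := by
      refine sum_abs_le_sqrt_sum_sq_div _ _ (fun w => ?_) (fun w h => ?_) ?_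
      · have := mul_nonneg (add_nonneg (hs0 w) (hs1 w)) (ht0 w); linarith
      · have x := mul_nonneg (hs0 w) (ht0 w)
        have y := mul_nonneg (hs1 w) (ht0 w)
        nlinarith
      · have : ∑ w, (s₀ w + s₁ w) * t₀ w / 2 = (∑ w, s₀ w * t₀ w + ∑ w, s₁ w * t₀ w) / 2 := by
          rw [← sum_add_distrib, sum_div]; exact sum_congr rfl fun w _ => by ring
        rw [this, h00, h10]; norm_num
    have h2 : √VA ≤ √V := Real.sqrt_le_sqrt (by rw [hV]; linarith)
    calc _ ≤ ∑ w, (|(s₀ w - s₁ w) * t₀ w / 2| + |s₀ w * t₀ w - s₁ w * t₁ w|) := by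
          refine sum_le_sum fun w _ => ?_
          rw [← abs_neg ((s₀ w - s₁ w) * t₀ w / 2)]
          refine le_trans (le_of_eq ?_) (abs_add_le _ _)
          congr 1; ring
      _ ≤ _ := by rw [sum_add_distrib]; linarith
  · have h1 : ∑ w, |(t₀ w - t₁ w) * s₀ w / 2| ≤ √VB := by
      refine sum_abs_le_sqrt_sum_sq_div _ _ (fun w => ?_) (fun w h => ?_) ?_
      · have := mul_nonneg (add_nonneg (ht0 w) (ht1 w)) (hs0 w); linarith
      · have x := mul_nonneg (ht0 w) (hs0 w)
        have y := mul_nonneg (ht1 w) (hs0 w)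
        nlinarith
      · have : ∑ w, (t₀ w + t₁ w) * s₀ w / 2 = (∑ w, s₀ w * t₀ w + ∑ w, s₀ w * t₁ w) / 2 := by
          rw [← sum_add_distrib, sum_div]; exact sum_congr rfl fun w _ => by ring
        rw [this, h00, h01]; norm_num
    have h2 : √VB ≤ √V := Real.sqrt_le_sqrt (by rw [hV]; linarith)
    calc _ ≤ ∑ w, (|(t₀ w - t₁ w) * s₀ w / 2| + |s₀ w * t₀ w - s₁ w * t₁ w|) := by
          refine sum_le_sum fun w _ => ?_
          rw [← abs_neg ((t₀ w - t₁ w) * s₀ w / 2)]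
          refine le_trans (le_of_eq ?_) (abs_add_le _ _)
          congr 1; ring
      _ ≤ _ := by rw [sum_add_distrib]; linarith

end CutAndPaste

/-- The entropy of a distribution with support of size at most `N` is at most `log N`. -/
theorem sum_negMulLog_le_log {W : Type*} [Fintype W] (p : W → ℝ) (hp : ∀ w, 0 ≤ p w)
    (h1 : ∑ w, p w = 1) (s : Finset W) (hs : ∀ w, w ∉ s → p w = 0) (N : ℕ) (hN : #s ≤ N) :
    ∑ w, Real.negMulLog (p w) ≤ Real.log N := by
  have hsum : ∀ g : W → ℝ, (∀ w, w ∉ s → g w = 0) → ∑ w, g w = ∑ w ∈ s, g w := fun g hg =>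
    (sum_subset (subset_univ s) fun w _ hw => hg w hw).symm
  have hNpos : 0 < N := by
    rcases Nat.eq_zero_or_pos N with rfl | h
    · rw [Nat.le_zero, card_eq_zero] at hN
      rw [hsum p hs, hN] at h1
      simp at h1
    · exact h
  have hN' : (0 : ℝ) < N := by exact_mod_cast hNpos
  have key : ∀ w, Real.negMulLog (p w) - p w * Real.log N ≤ 1 / N - p w := by
    intro w
    rcases (hp w).eq_or_lt with h | h
    · rw [← h]; simp
    · have := Real.log_le_sub_one_of_pos (show 0 < 1 / (N * p w) by positivity)
      rw [Real.log_div one_ne_zero (by positivity), Real.log_one,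
        Real.log_mul hN'.ne' h.ne'] at this
      calc _ = p w * (0 - (Real.log N + Real.log (p w))) := by rw [Real.negMulLog]; ring
        _ ≤ p w * (1 / (N * p w) - 1) := mul_le_mul_of_nonneg_left this h.le
        _ = _ := by field_simp
  have h2 : ∑ w ∈ s, (Real.negMulLog (p w) - p w * Real.log N) ≤ ∑ w ∈ s, (1 / (N : ℝ) - p w) :=
    sum_le_sum fun w _ => key w
  rw [sum_sub_distrib, sum_sub_distrib, ← sum_mul, ← hsum p hs, h1, ← hsum _ (fun w hw => by
    rw [hs w hw, Real.negMulLog_zero])] at h2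
  have h3 : ∑ w ∈ s, 1 / (N : ℝ) ≤ 1 := by
    rw [sum_const, nsmul_eq_mul, mul_one_div, div_le_one hN']
    exact_mod_cast hN
  linarith

/-! ### Rectangular functions of masked strings -/

theorem expect_sqrt_le {ι : Type*} [Fintype ι] (g : ι → ℝ) (hg : ∀ i, 0 ≤ g i) :
    𝔼 i, √(g i) ≤ √(𝔼 i, g i) := by
  refine Real.le_sqrt_of_sq_le ?_
  have h := expect_mul_sq_le_sq_mul_sq (univ : Finset ι) (fun i => √(g i)) (fun _ => (1 : ℝ))
  simp only [mul_one, Real.sq_sqrt (hg _), one_pow] at h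
  refine h.trans (mul_le_of_le_one_right (expect_nonneg fun i _ => hg i) ?_)
  rcases isEmpty_or_nonempty ι with hι | hι
  · simp
  · simp

/-- A function of two arguments all of whose fibres are combinatorial rectangles. -/
def IsRectangular {A B W : Type*} (f : A → B → W) : Prop :=
  ∀ a a' b b', f a b = f a' b' → f a' b = f a b

theorem IsRectangular.eq_iff {A B W : Type*} {f : A → B → W} (hf : IsRectangular f) {a b w} :
    f a b = w ↔ (∃ b', f a b' = w) ∧ ∃ a', f a' b = w := by
  constructor
  · exact fun h => ⟨⟨b, h⟩, ⟨a, h⟩⟩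
  · rintro ⟨⟨b', h⟩, ⟨a', h'⟩⟩
    exact (hf a' a b b' (h'.trans h.symm)).trans h'

section Masks

variable {Z : Type*}

/-- The string `r` with the positions outside `D` erased. -/
def maskTrue (D r : Z → Bool) : Z → Bool := fun c => D c && r c

/-- The string `r` with the positions in `D` erased. -/
def maskFalse (D r : Z → Bool) : Z → Bool := fun c => !D c && r c

variable [Fintype Z] [DecidableEq Z] {W : Type*} [Fintype W]

open Classical in
/-- The conditional bias energy of the coordinate `c`, given the value of a function `f` of the
two strings masked by `D`: the sum over the values `w` of `f` of the density of the fibre of `w`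
times the squared bias of the bit at `c` on this fibre. -/
noncomputable def biasEnergy (f : (Z → Bool) → (Z → Bool) → W) (D : Z → Bool) (c : Z) : ℝ :=
  ∑ w, (𝔼 r, if f (maskTrue D r) (maskFalse D r) = w then boolSign (r c) else 0) ^ 2 /
    𝔼 r, if f (maskTrue D r) (maskFalse D r) = w then 1 else 0

theorem expect_indicator_nonneg {ι : Type*} [Fintype ι] (P : ι → Prop) [DecidablePred P] :
    (0 : ℝ) ≤ 𝔼 i, if P i then 1 else 0 :=
  expect_nonneg fun i _ => by split_ifs <;> norm_num

theorem sum_expect_indicator_eq_one {ι : Type*} [Fintype ι] [Nonempty ι] [DecidableEq W]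
    (g : ι → W) : ∑ w, 𝔼 i, (if g i = w then (1 : ℝ) else 0) = 1 := by
  rw [← expect_sum_comm]
  simp

theorem biasEnergy_nonneg (f : (Z → Bool) → (Z → Bool) → W) (D : Z → Bool) (c : Z) :
    0 ≤ biasEnergy f D c :=
  sum_nonneg fun _ _ => div_nonneg (sq_nonneg _) (by classical exact expect_indicator_nonneg _)

/-- The total bias energy is at most twice the entropy of the value of `f`. -/
theorem sum_biasEnergy_le (f : (Z → Bool) → (Z → Bool) → W) (D : Z → Bool) (s : Finset W)
    (hs : ∀ r, f (maskTrue D r) (maskFalse D r) ∈ s) (N : ℕ) (hN : #s ≤ N) :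
    ∑ c, biasEnergy f D c ≤ 2 * Real.log N := by
  classical
  unfold biasEnergy
  set p : W → ℝ := fun w => 𝔼 r, if f (maskTrue D r) (maskFalse D r) = w then 1 else 0 with hp
  have h1 : ∑ w, Real.negMulLog (p w) ≤ Real.log N := by
    refine sum_negMulLog_le_log p (fun w => expect_indicator_nonneg _)
      (sum_expect_indicator_eq_one _) s (fun w hw => ?_) N hN
    refine expect_eq_zero fun r _ => if_neg ?_
    rintro rfl
    exact hw (hs r)
  rw [sum_comm]
  calc _ ≤ ∑ w, 2 * Real.negMulLog (p w) := by
        refine sum_le_sum fun w _ => ?_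
        rw [← sum_div]
        have h := sum_sq_expect_boolSign_le (fun r => f (maskTrue D r) (maskFalse D r) = w)
        have hp0 : 0 ≤ p w := expect_indicator_nonneg _
        rcases hp0.eq_or_lt with h0 | h0
        · change _ / p w ≤ _
          rw [← h0]; simp
        · change _ / p w ≤ _
          rw [div_le_iff₀ h0]
          refine h.trans (le_of_eq ?_)
          change 2 * p w * Real.negMulLog (p w) = _
          ring
    _ ≤ _ := by rw [← mul_sum]; linarith

/-- Forcing both strings to have the bit `1` at `c` changes the distribution of a rectangular
function by little if the bias energies of `c` are small for both values of the mask at `c`. -/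
theorem sum_abs_sub_force_le [DecidableEq W] (f : (Z → Bool) → (Z → Bool) → W)
    (hf : IsRectangular f) (D : Z → Bool) (c : Z) :
    ∑ w, |(𝔼 r, if f (maskTrue D r) (maskFalse D r) = w then (1 : ℝ) else 0) -
      𝔼 r, if f (Function.update (maskTrue D r) c true)
        (Function.update (maskFalse D r) c true) = w then (1 : ℝ) else 0| ≤
      5 * √(biasEnergy f (Function.update D c true) c
        + biasEnergy f (Function.update D c false) c) := by
  classical
  let s : Bool → W → ℝ := fun β w =>
    𝔼 r, if ∃ b', f (Function.update (maskTrue D r) c β) b' = w then 1 else 0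
  let t : Bool → W → ℝ := fun β w =>
    𝔼 r, if ∃ a', f a' (Function.update (maskFalse D r) c β) = w then 1 else 0
  have hs : ∀ β w, 0 ≤ s β w := fun β w => expect_indicator_nonneg _
  have ht : ∀ β w, 0 ≤ t β w := fun β w => expect_indicator_nonneg _
  have hmul : ∀ β β' w, 𝔼 r, (if f (Function.update (maskTrue D r) c β)
      (Function.update (maskFalse D r) c β') = w then (1 : ℝ) else 0) = s β w * t β' w := by
    intro β β' w
    rw [← expect_mul_eq_of_dependsOn D
      (fun r => if ∃ b', f (Function.update (maskTrue D r) c β) b' = w then (1 : ℝ) else 0)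
      (fun r => if ∃ a', f a' (Function.update (maskFalse D r) c β') = w then (1 : ℝ) else 0)]
    · refine expect_congr rfl fun r _ => ?_
      rw [if_congr hf.eq_iff rfl rfl]
      by_cases h1 : ∃ b', f (Function.update (maskTrue D r) c β) b' = w <;>
        by_cases h2 : ∃ a', f a' (Function.update (maskFalse D r) c β') = w <;>
        simp [h1, h2]
    · intro r r' h
      have : maskTrue D r = maskTrue D r' := by
        funext i
        rcases hi : D i with _ | _
        · simp [maskTrue, hi]
        · simp [maskTrue, hi, h i hi]
      simp only [this]
    · intro r r' h
      have : maskFalse D r = maskFalse D r' := by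
        funext i
        rcases hi : D i with _ | _
        · simp [maskFalse, hi, h i hi]
        · simp [maskFalse, hi]
      simp only [this]
  have hone : ∀ β β', ∑ w, s β w * t β' w = 1 := by
    intro β β'
    simp_rw [← hmul]
    exact sum_expect_indicator_eq_one _
  have mT1 : ∀ r β, maskTrue (Function.update D c true) (Function.update r c β)
      = Function.update (maskTrue D r) c β := by
    intro r β; funext i
    by_cases h : i = c
    · subst h; simp [maskTrue]
    · simp [maskTrue, h]
  have mF1 : ∀ r β, maskFalse (Function.update D c true) (Function.update r c β)
      = Function.update (maskFalse D r) c false := by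
    intro r β; funext i
    by_cases h : i = c
    · subst h; simp [maskFalse]
    · simp [maskFalse, h]
  have mT0 : ∀ r β, maskTrue (Function.update D c false) (Function.update r c β)
      = Function.update (maskTrue D r) c false := by
    intro r β; funext i
    by_cases h : i = c
    · subst h; simp [maskTrue]
    · simp [maskTrue, h]
  have mF0 : ∀ r β, maskFalse (Function.update D c false) (Function.update r c β)
      = Function.update (maskFalse D r) c β := by
    intro r β; funext i
    by_cases h : i = c
    · subst h; simp [maskFalse]
    · simp [maskFalse, h]
  have hneg : ∀ (g : (Z → Bool) → Prop) [DecidablePred g],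
      𝔼 r, (if g r then (-1 : ℝ) else 0) = -𝔼 r, if g r then (1 : ℝ) else 0 := by
    intro g _
    rw [← expect_neg_distrib]
    exact expect_congr rfl fun r _ => by split_ifs <;> simp
  have p1 : ∀ w, 𝔼 r, (if f (maskTrue (Function.update D c true) r)
      (maskFalse (Function.update D c true) r) = w then (1 : ℝ) else 0)
        = (s false w + s true w) * t false w / 2 := by
    intro w
    rw [expect_cube_eq_update c]
    simp only [mT1, mF1, hmul]
    ring
  have m1 : ∀ w, 𝔼 r, (if f (maskTrue (Function.update D c true) r)
      (maskFalse (Function.update D c true) r) = w then boolSign (r c) else 0)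
        = (s false w - s true w) * t false w / 2 := by
    intro w
    rw [expect_cube_eq_update c]
    simp only [mT1, mF1, Function.update_self, boolSign, if_true, Bool.false_eq_true, if_false,
      hneg, hmul]
    ring
  have p0 : ∀ w, 𝔼 r, (if f (maskTrue (Function.update D c false) r)
      (maskFalse (Function.update D c false) r) = w then (1 : ℝ) else 0)
        = (t false w + t true w) * s false w / 2 := by
    intro w
    rw [expect_cube_eq_update c]
    simp only [mT0, mF0, hmul]
    ring
  have m0 : ∀ w, 𝔼 r, (if f (maskTrue (Function.update D c false) r)
      (maskFalse (Function.update D c false) r) = w then boolSign (r c) else 0)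
        = (t false w - t true w) * s false w / 2 := by
    intro w
    rw [expect_cube_eq_update c]
    simp only [mT0, mF0, Function.update_self, boolSign, if_true, Bool.false_eq_true, if_false,
      hneg, hmul]
    ring
  have hV : biasEnergy f (Function.update D c true) c + biasEnergy f (Function.update D c false) c
      = ∑ w, ((s false w - s true w) * t false w / 2) ^ 2 / ((s false w + s true w) * t false w / 2)
      + ∑ w, ((t false w - t true w) * s false w / 2) ^ 2
        / ((t false w + t true w) * s false w / 2) := by
    unfold biasEnergy
    congr 1
    · exact sum_congr rfl fun w _ => by rw [← p1, ← m1]; congr!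
    · exact sum_congr rfl fun w _ => by rw [← p0, ← m0]; congr!
  have key := sum_abs_sub_diag_le (s false) (s true) (t false) (t true) (hs _) (hs _) (ht _) (ht _)
    (hone _ _) (hone _ _) (hone _ _) (hone _ _) _ hV
  simp only [hmul]
  rcases hD : D c with _ | _
  · have hD' : Function.update D c false = D := by rw [← hD]; exact Function.update_eq_self c D
    rw [hD'] at p0
    simp only [p0]
    exact key.2
  · have hD' : Function.update D c true = D := by rw [← hD]; exact Function.update_eq_self c D
    rw [hD'] at p1
    simp only [p1]
    exact key.1

theorem abs_expect_comp_sub_le {ι : Type*} [Fintype ι] [DecidableEq W] (g h : ι → W) (φ : W → ℝ)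
    (hφ : ∀ w, |φ w| ≤ 1) :
    |𝔼 i, (φ (g i) - φ (h i))| ≤
      ∑ w, |(𝔼 i, if g i = w then (1 : ℝ) else 0) - 𝔼 i, if h i = w then (1 : ℝ) else 0| := by
  have e : ∀ g : ι → W, 𝔼 i, φ (g i) = ∑ w, φ w * 𝔼 i, if g i = w then (1 : ℝ) else 0 := by
    intro g
    simp_rw [mul_expect]
    rw [← expect_sum_comm]
    exact expect_congr rfl fun i _ => by simp
  rw [expect_sub_distrib, e, e, ← sum_sub_distrib]
  refine (abs_sum_le_sum_abs _ _).trans (sum_le_sum fun w _ => ?_)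
  rw [← mul_sub, abs_mul]
  exact mul_le_of_le_one_left (abs_nonneg _) (hφ w)

theorem expect_abs_sub_force_le_of_fintype (f : (Z → Bool) → (Z → Bool) → W)
    (hf : IsRectangular f) (s : Finset W) (hs : ∀ D r, f (maskTrue D r) (maskFalse D r) ∈ s)
    (N : ℕ) (hN : #s ≤ N) (φ : Z → W → ℝ) (hφ : ∀ c w, |φ c w| ≤ 1) :
    𝔼 c, |𝔼 D, 𝔼 r, (φ c (f (maskTrue D r) (maskFalse D r)) -
      φ c (f (Function.update (maskTrue D r) c true) (Function.update (maskFalse D r) c true)))| ≤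
      10 * √(Real.log N / Fintype.card Z) := by
  classical
  calc _ ≤ 𝔼 c, 𝔼 D, 5 * √(biasEnergy f (Function.update D c true) c
        + biasEnergy f (Function.update D c false) c) := by
        refine expect_le_expect fun c _ => (abs_expect_le _ _).trans ?_
        refine expect_le_expect fun D _ => ?_
        exact (abs_expect_comp_sub_le _ _ (φ c) (hφ c)).trans (sum_abs_sub_force_le f hf D c)
    _ ≤ 5 * √(𝔼 c, 𝔼 D, (biasEnergy f (Function.update D c true) c
        + biasEnergy f (Function.update D c false) c)) := by
        simp_rw [← mul_expect]
        refine mul_le_mul_of_nonneg_left ?_ (by norm_num)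
        refine le_trans ?_ (expect_sqrt_le _ fun c => expect_nonneg fun D _ =>
          add_nonneg (biasEnergy_nonneg _ _ _) (biasEnergy_nonneg _ _ _))
        exact expect_le_expect fun c _ => expect_sqrt_le _ fun D =>
          add_nonneg (biasEnergy_nonneg _ _ _) (biasEnergy_nonneg _ _ _)
    _ ≤ 5 * √(4 * (Real.log N / Fintype.card Z)) := by
        refine mul_le_mul_of_nonneg_left (Real.sqrt_le_sqrt ?_) (by norm_num)
        have h1 : ∀ c, 𝔼 D, (biasEnergy f (Function.update D c true) c
            + biasEnergy f (Function.update D c false) c) = 2 * 𝔼 D, biasEnergy f D c := by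
          intro c
          rw [expect_cube_eq_update c (fun D => biasEnergy f D c), expect_add_distrib]
          ring
        simp_rw [h1]
        rw [← mul_expect, expect_comm]
        have h2 : 𝔼 D, 𝔼 c, biasEnergy f D c ≤ 2 * (Real.log N / Fintype.card Z) := by
          refine expect_le univ_nonempty fun D _ => ?_
          rw [Fintype.expect_eq_sum_div_card, ← mul_div_assoc]
          exact div_le_div_of_nonneg_right (sum_biasEnergy_le f D s (hs D) N hN)
            (Nat.cast_nonneg _)
        linarith
    _ = _ := by
        rw [Real.sqrt_mul (by norm_num), show (4 : ℝ) = 2 ^ 2 by norm_num,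
          Real.sqrt_sq (by norm_num)]
        ring

end Masks

/-- Forcing both strings to have the bit `1` at a random position changes the distribution of a
rectangular function taking at most `N` values on disjoint strings by `O(√(log N / |Z|))`. -/
theorem expect_abs_sub_force_le {Z W : Type*} [Fintype Z] [DecidableEq Z]
    (f : (Z → Bool) → (Z → Bool) → W)
    (hf : IsRectangular f) (s : Finset W) (hs : ∀ D r, f (maskTrue D r) (maskFalse D r) ∈ s)
    (N : ℕ) (hN : #s ≤ N) (φ : Z → W → ℝ) (hφ : ∀ c w, |φ c w| ≤ 1) :
    𝔼 c, |𝔼 D, 𝔼 r, (φ c (f (maskTrue D r) (maskFalse D r)) -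
      φ c (f (Function.update (maskTrue D r) c true) (Function.update (maskFalse D r) c true)))| ≤
      10 * √(Real.log N / Fintype.card Z) := by
  classical
  have : Fintype (Set.range fun q : (Z → Bool) × (Z → Bool) => f q.1 q.2) :=
    Fintype.ofFinite _
  refine expect_abs_sub_force_le_of_fintype
    (W := Set.range fun q : (Z → Bool) × (Z → Bool) => f q.1 q.2)
    (fun a b => ⟨f a b, ⟨(a, b), rfl⟩⟩) ?_ (s.subtype _) (fun D r => ?_) N ?_
    (fun c w => φ c w) (fun c w => hφ c w)
  · intro a a' b b' h
    exact Subtype.ext (hf a a' b b' (congrArg Subtype.val h))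
  · simpa using hs D r
  · refine le_trans ?_ hN
    rw [card_subtype]
    exact card_filter_le _ _

/-! ### Hiding the intersection of two sets -/

/-- Exchanging the target of `x` with an independent uniform element preserves the distribution. -/
theorem expect_target_swap {X Y : Type*} [DecidableEq X] [Fintype X] [Fintype Y]
    (x : X) (g : (X → Y) → Y → ℝ) :
    𝔼 t : X → Y, 𝔼 i, g t i = 𝔼 t : X → Y, 𝔼 i, g (Function.update t x i) (t x) := by
  rw [← expect_product' univ univ g, ← expect_product' univ univ
    (fun t i => g (Function.update t x i) (t x)), univ_product_univ]
  have hinv : Function.Involutive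
      (fun q : (X → Y) × Y => (Function.update q.1 x q.2, q.1 x)) := by
    intro q
    ext <;> simp
  exact (Fintype.expect_equiv hinv.toPerm _ _ fun q => rfl).symm

section Gadget

variable {X Y : Type*} [Fintype Y] [DecidableEq Y]

/-- The sets with the characteristic functions `a (x, ·)`, each enlarged by the target `t x`. -/
def plantedSets (t : X → Y) (a : X × Y → Bool) (x : X) : Finset Y :=
  univ.filter fun y => y = t x ∨ a (x, y) = true

/-- A hard family of set intersection instances indexed by `X`: the targets, a mask splitting the
universe of every instance into two parts, and a string of bits. The first set consists of the
target and the elements of the first part with bit `1`, the second set of the target and the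
elements of the second part with bit `1`. -/
abbrev Gadget (X Y : Type*) : Type _ := (X → Y) × (X × Y → Bool) × (X × Y → Bool)

/-- The first sets of all instances. -/
def Gadget.setA (α : Gadget X Y) : X → Finset Y := plantedSets α.1 (maskTrue α.2.1 α.2.2)

/-- The second sets of all instances. -/
def Gadget.setB (α : Gadget X Y) : X → Finset Y := plantedSets α.1 (maskFalse α.2.1 α.2.2)

theorem Gadget.setA_inter_setB (α : Gadget X Y) (x : X) : α.setA x ∩ α.setB x = {α.1 x} := by
  ext y
  rcases h : α.2.1 (x, y) with _ | _ <;>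
    simp [Gadget.setA, Gadget.setB, plantedSets, maskTrue, maskFalse, h] <;> exact Or.inl

variable [DecidableEq X]

/-- Planting the targets `t` and adding `i` to the set of `x` is symmetric in `t x` and `i`. -/
theorem plantedSets_update_comm (t : X → Y) (a : X × Y → Bool) (x : X) (i : Y) :
    plantedSets t (Function.update a (x, i) true)
      = plantedSets (Function.update t x i) (Function.update a (x, t x) true) := by
  funext x'
  ext y
  by_cases hx : x' = x
  · subst hx
    simp only [plantedSets, mem_filter, mem_univ, true_and, Function.update_self,
      Function.update_apply, Prod.mk.injEq]
    by_cases h1 : y = i <;> by_cases h2 : y = t x' <;> simp [h1, h2]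
  · simp [plantedSets, hx]

variable [Fintype X]

theorem expect_gadget (g : Gadget X Y → ℝ) :
    𝔼 α, g α = 𝔼 t, 𝔼 D, 𝔼 r, g (t, D, r) := by
  rw [← univ_product_univ, expect_product]
  refine expect_congr rfl fun t _ => ?_
  rw [← univ_product_univ, expect_product]

/-- Direct-sum lower bound for finding the intersection. A rectangular function of the two
families of sets which takes at most `N` values leaves the target of a random instance close to
uniform, in the sense that no test `φ x` can tell it from an independent uniform element. The
function may depend on the targets except, for all but `k` of the instances `x`, on that of `x`. -/
theorem expect_test_target_le [Nonempty Y] {W : Type*}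
    (R : (X → Y) → (X → Finset Y) → (X → Finset Y) → W) (hR : ∀ t, IsRectangular (R t))
    (s : (X → Y) → Finset W)
    (hs : ∀ t D r, R t (plantedSets t (maskTrue D r)) (plantedSets t (maskFalse D r)) ∈ s t)
    (N : ℕ) (hN : ∀ t, #(s t) ≤ N) (bad : (X → Y) → Finset X) (k : ℕ) (hk : ∀ t, #(bad t) ≤ k)
    (hbad : ∀ t x, x ∉ bad t → ∀ i, R (Function.update t x i) = R t)
    (φ : X → W → Y → ℝ) (hφ0 : ∀ x w y, 0 ≤ φ x w y) (hφ1 : ∀ x w y, φ x w y ≤ 1) :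
    𝔼 x, 𝔼 α : Gadget X Y, (φ x (R α.1 α.setA α.setB) (α.1 x)
        - 𝔼 u, φ x (R α.1 α.setA α.setB) u) ≤
      k / Fintype.card X
        + 20 * √(Real.log N / (Fintype.card X * Fintype.card Y : ℕ)) := by
  have hφabs : ∀ x w y, |φ x w y| ≤ 1 := fun x w y => abs_le.2 ⟨by linarith [hφ0 x w y], hφ1 x w y⟩
  -- `P` is the average of a test over the instances with targets `t`, and `Q` the same average
  -- after the element `c.2` has been added to both sets of the instance `c.1`.
  let P : (X → Y) → (W → ℝ) → ℝ := fun t ψ => 𝔼 D, 𝔼 r,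
    ψ (R t (plantedSets t (maskTrue D r)) (plantedSets t (maskFalse D r)))
  let Q : (X → Y) → X × Y → (W → ℝ) → ℝ := fun t c ψ => 𝔼 D, 𝔼 r,
    ψ (R t (plantedSets t (Function.update (maskTrue D r) c true))
      (plantedSets t (Function.update (maskFalse D r) c true)))
  have core : ∀ t (ψ : X × Y → W → ℝ), (∀ c w, |ψ c w| ≤ 1) →
      𝔼 c, |P t (ψ c) - Q t c (ψ c)| ≤
        10 * √(Real.log N / (Fintype.card X * Fintype.card Y : ℕ)) := by
    intro t ψ hψ
    have := expect_abs_sub_force_le (fun a b => R t (plantedSets t a) (plantedSets t b))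
      (fun a a' b b' h => hR t _ _ _ _ h) (s t) (hs t) N (hN t) ψ hψ
    rw [Fintype.card_prod] at this
    simpa only [expect_sub_distrib] using this
  have core' : ∀ (ψ : (X → Y) → X → Y → W → ℝ), (∀ t x i w, |ψ t x i w| ≤ 1) →
      𝔼 x, 𝔼 t, 𝔼 i, |P t (ψ t x i) - Q t (x, i) (ψ t x i)| ≤
        10 * √(Real.log N / (Fintype.card X * Fintype.card Y : ℕ)) := by
    intro ψ hψ
    rw [expect_comm]
    refine expect_le univ_nonempty fun t _ => ?_
    have := core t (fun c => ψ t c.1 c.2) (fun c => hψ t c.1 c.2)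
    rwa [← univ_product_univ, expect_product] at this
  have swap : ∀ x, 𝔼 α : Gadget X Y, (φ x (R α.1 α.setA α.setB) (α.1 x)
        - 𝔼 u, φ x (R α.1 α.setA α.setB) u)
      = 𝔼 t, 𝔼 i, (P t (fun w => φ x w (t x))
          - P (Function.update t x i) (fun w => φ x w (t x))) := by
    intro x
    have h2 : 𝔼 t, 𝔼 i, P t (fun w => φ x w i)
        = 𝔼 t, 𝔼 i, P (Function.update t x i) (fun w => φ x w (t x)) :=
      expect_target_swap x (fun t i => P t (fun w => φ x w i))
    rw [expect_gadget]
    simp only [expect_sub_distrib]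
    rw [← h2]
    congr 1
    · refine expect_congr rfl fun t _ => ?_
      rw [Fintype.expect_const]
      rfl
    · refine expect_congr rfl fun t _ => ?_
      simp only [P]
      rw [expect_comm univ univ (fun i D => 𝔼 r,
        φ x (R t (plantedSets t (maskTrue D r)) (plantedSets t (maskFalse D r))) i)]
      refine expect_congr rfl fun D _ => ?_
      rw [expect_comm]
      rfl
  have hP0 : ∀ t x y, 0 ≤ P t (fun w => φ x w y) := fun t x y =>
    expect_nonneg fun D _ => expect_nonneg fun r _ => hφ0 _ _ _
  have hP1 : ∀ t x y, P t (fun w => φ x w y) ≤ 1 := fun t x y =>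
    expect_le univ_nonempty fun D _ => expect_le univ_nonempty fun r _ => hφ1 _ _ _
  have step : ∀ x t i, P t (fun w => φ x w (t x))
      - P (Function.update t x i) (fun w => φ x w (t x)) ≤
      (if x ∈ bad t then 1 else 0)
        + |P t (fun w => φ x w (t x)) - Q t (x, i) (fun w => φ x w (t x))|
        + |P (Function.update t x i) (fun w => φ x w (t x))
            - Q (Function.update t x i) (x, t x) (fun w => φ x w (t x))| := by
    intro x t i
    have a1 := abs_nonneg (P t (fun w => φ x w (t x)) - Q t (x, i) (fun w => φ x w (t x)))
    have a2 := abs_nonneg (P (Function.update t x i) (fun w => φ x w (t x))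
            - Q (Function.update t x i) (x, t x) (fun w => φ x w (t x)))
    split_ifs with hx
    · have := hP1 t x (t x)
      have := hP0 (Function.update t x i) x (t x)
      linarith
    · have e : Q t (x, i) (fun w => φ x w (t x))
          = Q (Function.update t x i) (x, t x) (fun w => φ x w (t x)) := by
        simp only [Q, hbad t x hx i, plantedSets_update_comm t]
      rw [← e] at a2 ⊢
      have := le_abs_self (P t (fun w => φ x w (t x)) - Q t (x, i) (fun w => φ x w (t x)))
      have := neg_abs_le (P (Function.update t x i) (fun w => φ x w (t x))
            - Q t (x, i) (fun w => φ x w (t x)))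
      linarith
  have hbad' : 𝔼 x, 𝔼 t, 𝔼 _i : Y, (if x ∈ bad t then (1 : ℝ) else 0) ≤ k / Fintype.card X := by
    rw [expect_comm]
    refine expect_le univ_nonempty fun t _ => ?_
    simp only [Fintype.expect_const]
    rw [Fintype.expect_eq_sum_div_card]
    refine div_le_div_of_nonneg_right ?_ (Nat.cast_nonneg _)
    rw [sum_ite_mem, univ_inter, sum_const, nsmul_eq_mul, mul_one]
    exact_mod_cast hk t
  have e1 := core' (fun t x _ w => φ x w (t x)) (fun _ _ _ _ => hφabs _ _ _)
  have e2 := core' (fun _ x i w => φ x w i) (fun _ _ _ _ => hφabs _ _ _)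
  have e2' : 𝔼 x, 𝔼 t, 𝔼 i, |P t (fun w => φ x w i) - Q t (x, i) (fun w => φ x w i)|
      = 𝔼 x, 𝔼 t, 𝔼 i, |P (Function.update t x i) (fun w => φ x w (t x))
            - Q (Function.update t x i) (x, t x) (fun w => φ x w (t x))| :=
    expect_congr rfl fun x _ => expect_target_swap x
      (fun t i => |P t (fun w => φ x w i) - Q t (x, i) (fun w => φ x w i)|)
  simp_rw [swap]
  calc _ ≤ 𝔼 x, 𝔼 t, 𝔼 i, ((if x ∈ bad t then (1 : ℝ) else 0)
        + |P t (fun w => φ x w (t x)) - Q t (x, i) (fun w => φ x w (t x))|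
        + |P (Function.update t x i) (fun w => φ x w (t x))
            - Q (Function.update t x i) (x, t x) (fun w => φ x w (t x))|) :=
        expect_le_expect fun x _ => expect_le_expect fun t _ => expect_le_expect fun i _ =>
          step x t i
    _ ≤ _ := by
        simp only [expect_add_distrib] at *
        linarith

end Gadget

/-! ### Chasing a hidden pointer -/

theorem expect_eq_expect_fiber {P W : Type*} [Fintype P] [DecidableEq W] (g : P → W) (F : P → ℝ) :
    𝔼 p, F p = 𝔼 p, 𝔼 p' ∈ univ.filter (fun p' => g p' = g p), F p' := by
  rw [Fintype.expect_eq_sum_div_card, Fintype.expect_eq_sum_div_card]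
  congr 1
  have h : ∀ p, 𝔼 p' ∈ univ.filter (fun p' => g p' = g p), F p'
      = ∑ p', if g p = g p' then F p' / #(univ.filter fun p'' => g p'' = g p') else 0 := by
    intro p
    rw [expect_eq_sum_div_card, sum_div, sum_filter]
    refine sum_congr rfl fun p' _ => ?_
    by_cases hp : g p' = g p
    · simp [hp]
    · simp [hp, Ne.symm hp]
  simp_rw [h]
  rw [sum_comm]
  refine sum_congr rfl fun p' _ => ?_
  rw [← sum_filter, sum_const, nsmul_eq_mul, mul_div_cancel₀]
  exact Nat.cast_ne_zero.2 (card_ne_zero_of_mem (mem_filter.2 ⟨mem_univ p', rfl⟩))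

theorem exists_best_test {P Y : Type*} [Fintype Y] [Nonempty Y] (E : Finset P) (g : P → Y) :
    ∃ φ' : {φ : Y → ℝ // ∀ y, 0 ≤ φ y ∧ φ y ≤ 1}, ∀ φ : {φ : Y → ℝ // ∀ y, 0 ≤ φ y ∧ φ y ≤ 1},
      𝔼 p ∈ E, (φ.1 (g p) - 𝔼 u, φ.1 u) ≤ 𝔼 p ∈ E, (φ'.1 (g p) - 𝔼 u, φ'.1 u) := by
  classical
  rcases E.eq_empty_or_nonempty with rfl | hE
  · exact ⟨⟨fun _ => 0, fun _ => by simp⟩, fun φ => by simp⟩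
  -- The advantage of a test is linear in the test.
  let a : Y → ℝ := fun u => (𝔼 p ∈ E, if g p = u then (1 : ℝ) else 0) - 1 / Fintype.card Y
  have key : ∀ φ : Y → ℝ, 𝔼 p ∈ E, (φ (g p) - 𝔼 u, φ u) = ∑ u, φ u * a u := by
    intro φ
    rw [expect_sub_distrib, expect_const hE, Fintype.expect_eq_sum_div_card]
    simp only [a, mul_sub, sum_sub_distrib, mul_expect]
    rw [← expect_sum_comm, ← sum_mul, mul_one_div]
    simp
  refine ⟨⟨fun u => if 0 < a u then 1 else 0, fun u => by dsimp only; split_ifs <;> simp⟩,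
    fun φ => ?_⟩
  rw [key, key]
  refine sum_le_sum fun u _ => ?_
  have := φ.2 u
  dsimp only
  split_ifs with h
  · nlinarith
  · nlinarith

section Pointer

variable {P Q Y V : Type*} [Fintype P] [Fintype Q] [Fintype Y]

/-- Given `W`, the variable `z` is uniform up to an error `δ` in total variation distance. The
inputs `p` and `q` of the two groups of players are uniform and independent. -/
def IsNearUniform (W : P → Q → V) (z : P → Q → Y) (δ : ℝ) : Prop :=
  ∀ ψ : V → Y → ℝ, (∀ w y, 0 ≤ ψ w y) → (∀ w y, ψ w y ≤ 1) →
    𝔼 p, 𝔼 q, ψ (W p q) (z p q) ≤ 𝔼 p, 𝔼 q, 𝔼 y, ψ (W p q) y + δ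

theorem IsNearUniform.swap {W : P → Q → V} {z : P → Q → Y} {δ : ℝ} (h : IsNearUniform W z δ) :
    IsNearUniform (fun q p => W p q) (fun q p => z p q) δ := by
  intro ψ h0 h1
  rw [expect_comm, expect_comm univ univ (fun q p => 𝔼 y, ψ (W p q) y)]
  exact h ψ h0 h1

/-- If the pointer `z` depends on `p` only through `W` and is close to uniform given `W`, then a
payoff collected at `z`, by a strategy that knows `W` and `q` but not `p`, is not much larger than
that collected at an independent uniform point by the strategy that is optimal given `W`. -/
theorem exists_expect_payoff_le {Θ : Type*} (W : P → Q → V) (hW : IsRectangular W)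
    (z : P → Q → Y) (hz : ∀ p p' q, W p q = W p' q → z p q = z p' q) {δ : ℝ}
    (hδ : IsNearUniform W z δ) (pay : Θ → Y → P → ℝ) (hpay : ∀ θ y p, pay θ y p ≤ 1)
    (hpay0 : ∃ θ, ∀ y p, 0 ≤ pay θ y p)
    (hbest : ∀ (E : Finset P) (y : Y), ∃ θ', ∀ θ,
      𝔼 p ∈ E, pay θ y p ≤ 𝔼 p ∈ E, pay θ' y p) :
    ∃ best : V → Y → Θ, ∀ θ : P → Q → Θ, (∀ p p' q, W p q = W p' q → θ p q = θ p' q) →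
      𝔼 p, 𝔼 q, pay (θ p q) (z p q) p ≤ 𝔼 y, 𝔼 p, 𝔼 q, pay (best (W p q) y) y p + δ := by
  classical
  let E : V → Finset P := fun w => univ.filter fun p => ∃ q, W p q = w
  have hE : ∀ p q, univ.filter (fun p' => W p' q = W p q) = E (W p q) := by
    intro p q
    ext p'
    simp only [E, mem_filter, mem_univ, true_and]
    exact ⟨fun h => ⟨q, h⟩, fun ⟨q', h⟩ => hW p p' q q' h.symm⟩
  choose best hbest using fun w y => hbest (E w) y
  refine ⟨best, fun θ hθ => ?_⟩
  let ψ : V → Y → ℝ := fun w y => 𝔼 p ∈ E w, pay (best w y) y p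
  have h0 : ∀ w y, 0 ≤ ψ w y := by
    intro w y
    obtain ⟨θ₀, h⟩ := hpay0
    exact (expect_nonneg fun p _ => h y p).trans (hbest w y θ₀)
  have h1 : ∀ w y, ψ w y ≤ 1 := by
    intro w y
    rcases (E w).eq_empty_or_nonempty with h | h
    · simp only [ψ, h, expect_empty, zero_le_one]
    · exact expect_le h fun p _ => hpay _ _ _
  have hL : 𝔼 p, 𝔼 q, pay (θ p q) (z p q) p ≤ 𝔼 p, 𝔼 q, ψ (W p q) (z p q) := by
    rw [expect_comm, expect_comm univ univ (fun p q => ψ (W p q) (z p q))]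
    refine expect_le_expect fun q _ => ?_
    rw [expect_eq_expect_fiber (fun p => W p q)]
    refine expect_le_expect fun p _ => ?_
    have : 𝔼 p' ∈ univ.filter (fun p' => W p' q = W p q), pay (θ p' q) (z p' q) p'
        = 𝔼 p' ∈ E (W p q), pay (θ p q) (z p q) p' := by
      rw [← hE]
      refine expect_congr rfl fun p' hp' => ?_
      have hp'' := (mem_filter.1 hp').2
      rw [hθ p' p q hp'', hz p' p q hp'']
    rw [this]
    exact hbest _ _ _
  have hR : 𝔼 p, 𝔼 q, 𝔼 y, ψ (W p q) y = 𝔼 y, 𝔼 p, 𝔼 q, pay (best (W p q) y) y p := by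
    have e1 : 𝔼 p, 𝔼 q, 𝔼 y, ψ (W p q) y = 𝔼 y, 𝔼 p, 𝔼 q, ψ (W p q) y := by
      rw [expect_comm univ univ (fun y p => 𝔼 q, ψ (W p q) y)]
      exact expect_congr rfl fun p _ => expect_comm _ _ _
    rw [e1]
    refine expect_congr rfl fun y _ => ?_
    rw [expect_comm, expect_comm univ univ (fun p q => pay (best (W p q) y) y p)]
    refine expect_congr rfl fun q _ => ?_
    rw [expect_eq_expect_fiber (fun p => W p q) (fun p => pay (best (W p q) y) y p)]
    refine expect_congr rfl fun p _ => ?_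
    rw [hE]
    refine expect_congr rfl fun p' hp' => ?_
    have hp'' : W p' q = W p q := by
      rw [← hE] at hp'
      exact (mem_filter.1 hp').2
    rw [hp'']
  rw [← hR]
  exact hL.trans (hδ ψ h0 h1)

/-- One step of pointer chasing. If `z` is close to uniform given `W`, and no test knowing `W` can
tell `f p y` for a random `y` from a uniform element, then `f p z` is close to uniform even given
`z` and further messages depending on `W` and `q`. -/
theorem IsNearUniform.step [Nonempty Y] {V' : Type*}
    {W : P → Q → V} (hW : IsRectangular W) {W' : P → Q → V'}
    (hW' : ∀ p p' q, W p q = W p' q → W' p q = W' p' q)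
    {z : P → Q → Y} (hz : ∀ p p' q, W p q = W p' q → z p q = z p' q) {δ ε : ℝ}
    (hδ : IsNearUniform W z δ) (f : P → Y → Y)
    (hε : ∀ φ : Y → V → Y → ℝ, (∀ x w y, 0 ≤ φ x w y) → (∀ x w y, φ x w y ≤ 1) →
      𝔼 x, 𝔼 p, 𝔼 q, (φ x (W p q) (f p x) - 𝔼 u, φ x (W p q) u) ≤ ε) :
    IsNearUniform W' (fun p q => f p (z p q)) (δ + ε) := by
  intro φ h0 h1
  obtain ⟨best, hbest⟩ := exists_expect_payoff_le W hW z hz hδ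
    (fun (θ : {φ : Y → ℝ // ∀ y, 0 ≤ φ y ∧ φ y ≤ 1}) y p => θ.1 (f p y) - 𝔼 u, θ.1 u)
    (fun θ y p => by
      have := (θ.2 (f p y)).2
      have : 0 ≤ 𝔼 u, θ.1 u := expect_nonneg fun u _ => (θ.2 u).1
      linarith)
    ⟨⟨fun _ => 0, fun _ => by simp⟩, fun y p => by simp⟩
    (fun E y => exists_best_test E fun p => f p y)
  have h := hbest (fun p q => ⟨φ (W' p q), fun y => ⟨h0 _ _, h1 _ _⟩⟩)
    (fun p p' q hp => by simp only [hW' p p' q hp])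
  have h' := hε (fun x w => (best w x).1) (fun x w y => ((best w x).2 y).1)
    (fun x w y => ((best w x).2 y).2)
  have e : 𝔼 p, 𝔼 q, (φ (W' p q) (f p (z p q)) - 𝔼 u, φ (W' p q) u)
      = 𝔼 p, 𝔼 q, φ (W' p q) (f p (z p q)) - 𝔼 p, 𝔼 q, 𝔼 u, φ (W' p q) u := by
    simp only [expect_sub_distrib]
  dsimp only at h
  rw [e] at h
  linarith

/-- The success probability of guessing `f p z` by one of finitely many guessers, chosen
depending on `W` and `q`, is bounded by that of guessing `f p y` at a random point `y`. -/
theorem IsNearUniform.exists_guess {H : Type*} [Finite H] [Nonempty H]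
    {W : P → Q → V} (hW : IsRectangular W)
    {z : P → Q → Y} (hz : ∀ p p' q, W p q = W p' q → z p q = z p' q) {δ : ℝ}
    (hδ : IsNearUniform W z δ) (f : P → Y → Y) (h : H → P → Y) [DecidableEq Y] :
    ∃ best : V → Y → H, ∀ θ : P → Q → H, (∀ p p' q, W p q = W p' q → θ p q = θ p' q) →
      𝔼 p, 𝔼 q, (if h (θ p q) p = f p (z p q) then (1 : ℝ) else 0) ≤
        𝔼 y, 𝔼 p, 𝔼 q, (if h (best (W p q) y) p = f p y then (1 : ℝ) else 0) + δ :=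
  exists_expect_payoff_le W hW z hz hδ
    (fun (θ : H) y p => if h θ p = f p y then (1 : ℝ) else 0)
    (fun θ y p => by split_ifs <;> norm_num)
    ⟨Classical.arbitrary H, fun y p => by split_ifs <;> norm_num⟩
    (fun E y => Finite.exists_max fun θ => 𝔼 p ∈ E, if h θ p = f p y then (1 : ℝ) else 0)

end Pointer

/-! ### Phases and transcripts of protocols -/

/-- The group of the players outside `g`. -/
def PlayerGroup.other : PlayerGroup → PlayerGroup
  | .AB => .CD
  | .CD => .AB

@[simp] theorem PlayerGroup.other_other (g : PlayerGroup) : g.other.other = g := by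
  cases g <;> rfl

theorem PlayerGroup.ne_iff {g h : PlayerGroup} : h ≠ g ↔ h = g.other := by
  cases g <;> cases h <;> simp [PlayerGroup.other]

/-- The alternating sequence of groups that starts with `g`. -/
def PlayerGroup.alternate (g : PlayerGroup) : ℕ → PlayerGroup
  | 0 => g
  | j + 1 => (g.alternate j).other

theorem PlayerGroup.alternate_other (g : PlayerGroup) (j : ℕ) :
    g.other.alternate j = (g.alternate j).other := by
  induction j with
  | zero => rfl
  | succ j ih => simp only [alternate, ih]

namespace Protocol

variable {In : Player → Type*} {Out : Type*}

/-- The part of the transcript sent in the current phase, which belongs to the group `g`, and the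
`j` phases after it. -/
def phasePrefix : Protocol In Out → PlayerGroup → ℕ → (∀ i, In i) → List (Player × Bool)
  | .answer _ _, _, _, _ => []
  | .speak i bit next, g, j, x =>
    if i.group = g then (i, bit (x i)) :: (next (bit (x i))).phasePrefix g j x
    else match j with
      | 0 => []
      | j + 1 => (i, bit (x i)) :: (next (bit (x i))).phasePrefix i.group j x

/-- The inputs that have a given message prefix form a rectangle. -/
theorem phasePrefix_eq_of_mix (π : Protocol In Out) (g : PlayerGroup) (j : ℕ)
    {x y z : ∀ i, In i} (hz : ∀ i, z i = x i ∨ z i = y i)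
    (h : π.phasePrefix g j x = π.phasePrefix g j y) :
    π.phasePrefix g j z = π.phasePrefix g j x := by
  induction π generalizing g j with
  | answer => rfl
  | speak i bit next ih =>
    have hbit : bit (x i) = bit (y i) → bit (z i) = bit (x i) := by
      intro e
      rcases hz i with h | h <;> rw [h]
      exact e.symm
    simp only [phasePrefix] at h ⊢
    split_ifs at h ⊢ with hi
    · simp only [List.cons.injEq, Prod.mk.injEq, true_and] at h ⊢
      refine ⟨hbit h.1, ?_⟩
      rw [hbit h.1]
      exact ih _ _ _ (by rw [h.2, h.1])
    · cases j with
      | zero => rfl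
      | succ j =>
        simp only [List.cons.injEq, Prod.mk.injEq, true_and] at h ⊢
        refine ⟨hbit h.1, ?_⟩
        rw [hbit h.1]
        exact ih _ _ _ (by rw [h.2, h.1])

theorem transcript_eq_of_mix (π : Protocol In Out) {x y z : ∀ i, In i}
    (hz : ∀ i, z i = x i ∨ z i = y i) (h : π.transcript x = π.transcript y) :
    π.transcript z = π.transcript x := by
  induction π with
  | answer => rfl
  | speak i bit next ih =>
    simp only [transcript, List.cons.injEq, Prod.mk.injEq, true_and] at h ⊢
    have hbit : bit (z i) = bit (x i) := by
      rcases hz i with h' | h' <;> rw [h']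
      exact h.1.symm
    refine ⟨hbit, ?_⟩
    rw [hbit]
    exact ih _ (by rw [h.2, h.1])

theorem exists_run_eq (π : Protocol In Out) (x : ∀ i, In i) :
    ∃ i, ∃ a : In i → Out, ∀ z, π.transcript z = π.transcript x → π.run z = a (z i) := by
  induction π with
  | answer i a => exact ⟨i, a, fun _ _ => rfl⟩
  | speak i bit next ih =>
    obtain ⟨l, a, h⟩ := ih (bit (x i))
    refine ⟨l, a, fun z hz => ?_⟩
    simp only [transcript, List.cons.injEq, Prod.mk.injEq, true_and] at hz
    simp only [run]
    obtain ⟨h1, h2⟩ := hz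
    rw [h1] at h2 ⊢
    exact h z h2

theorem run_eq_of_mix (π : Protocol In Out) {x y z : ∀ i, In i}
    (hz : ∀ i, z i = x i ∨ z i = y i) (h : π.transcript x = π.transcript y)
    (hrun : π.run x = π.run y) : π.run z = π.run x := by
  obtain ⟨i, a, ha⟩ := π.exists_run_eq x
  rw [ha z (π.transcript_eq_of_mix hz h)]
  rcases hz i with h' | h' <;> rw [h']
  · exact (ha x rfl).symm
  · rw [hrun]
    exact (ha y h.symm).symm

theorem phasePrefix_zero_congr (π : Protocol In Out) (g : PlayerGroup) {x y : ∀ i, In i}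
    (hxy : ∀ i : Player, i.group = g → x i = y i) :
    π.phasePrefix g 0 x = π.phasePrefix g 0 y := by
  induction π with
  | answer => rfl
  | speak i bit next ih =>
    simp only [phasePrefix]
    split_ifs with hi
    · rw [hxy i hi, ih]
    · rfl

/-- The messages of a phase depend on the messages before it and the data of the group whose
phase it is. -/
theorem phasePrefix_succ_congr (π : Protocol In Out) (g : PlayerGroup) (j : ℕ) {x y : ∀ i, In i}
    (hxy : ∀ i : Player, i.group = g.alternate (j + 1) → x i = y i)
    (h : π.phasePrefix g j x = π.phasePrefix g j y) :
    π.phasePrefix g (j + 1) x = π.phasePrefix g (j + 1) y := by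
  induction π generalizing g j with
  | answer => rfl
  | speak i bit next ih =>
    simp only [phasePrefix] at h ⊢
    split_ifs at h ⊢ with hi
    · simp only [List.cons.injEq, Prod.mk.injEq, true_and] at h ⊢
      refine ⟨h.1, ?_⟩
      rw [h.1]
      rw [h.1] at h
      exact ih _ _ _ hxy h.2
    · have hi' := PlayerGroup.ne_iff.1 hi
      cases j with
      | zero =>
        have hxi : x i = y i := hxy i hi'
        simp only [hxi]
        rw [phasePrefix_zero_congr _ _ fun i' hi'' => hxy i' (hi''.trans hi')]
      | succ j =>
        simp only [List.cons.injEq, Prod.mk.injEq, true_and] at h ⊢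
        refine ⟨h.1, ?_⟩
        rw [h.1]
        rw [h.1] at h
        refine ih _ _ _ (fun i' hi'' => hxy i' ?_) h.2
        rw [hi''.trans (congrArg (fun g : PlayerGroup => g.alternate (j + 1)) hi'),
          PlayerGroup.alternate_other]
        rfl

theorem length_phasePrefix_le (π : Protocol In Out) (g : PlayerGroup) (j : ℕ) (x : ∀ i, In i) :
    (π.phasePrefix g j x).length ≤ (π.transcript x).length := by
  induction π generalizing g j with
  | answer => rfl
  | speak i bit next ih =>
    simp only [phasePrefix, transcript]
    split_ifs with hi
    · simpa using ih _ _ _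
    · cases j with
      | zero => simp
      | succ j => simpa using ih _ _ _

theorem phasePrefix_eq_transcript (π : Protocol In Out) (g : PlayerGroup) (j : ℕ)
    (x : ∀ i, In i) (h : phasesFrom g ((π.transcript x).map Prod.fst) ≤ j + 1) :
    π.phasePrefix g j x = π.transcript x := by
  have hpos : ∀ (l : List Player) g, 1 ≤ phasesFrom g l := by
    intro l
    induction l with
    | nil => exact fun g => le_rfl
    | cons i l ih =>
      intro g
      simp only [phasesFrom]
      split_ifs
      · exact ih g
      · omega
  induction π generalizing g j with
  | answer => rfl
  | speak i bit next ih =>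
    simp only [phasePrefix, transcript, List.map_cons, phasesFrom] at h ⊢
    split_ifs at h ⊢ with hi
    · rw [ih _ _ _ h]
    · cases j with
      | zero =>
        have := hpos (((next (bit (x i))).transcript x).map Prod.fst) i.group
        omega
      | succ j => simp only; rw [ih _ _ _ (by omega)]

end Protocol

/-- The lists of length at most `b` over a finite alphabet. -/
def listsUpTo (A : Type*) [Fintype A] [DecidableEq A] : ℕ → Finset (List A)
  | 0 => {[]}
  | b + 1 => insert [] ((univ ×ˢ listsUpTo A b).image fun q : A × List A => q.1 :: q.2)

theorem mem_listsUpTo {A : Type*} [Fintype A] [DecidableEq A] {b : ℕ} {l : List A}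
    (h : l.length ≤ b) : l ∈ listsUpTo A b := by
  induction b generalizing l with
  | zero => simpa [listsUpTo] using h
  | succ b ih =>
    cases l with
    | nil => simp [listsUpTo]
    | cons a l => simpa [listsUpTo] using ih (by simpa using h)

theorem card_listsUpTo_le (A : Type*) [Fintype A] [DecidableEq A] (b : ℕ) :
    #(listsUpTo A b) ≤ (Fintype.card A + 1) ^ b := by
  induction b with
  | zero => simp [listsUpTo]
  | succ b ih =>
    refine (card_insert_le _ _).trans ?_
    have h1 := card_image_le (s := univ ×ˢ listsUpTo A b) (f := fun q : A × List A => q.1 :: q.2)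
    rw [card_product, card_univ] at h1
    have h2 := Nat.mul_le_mul_left (Fintype.card A) ih
    have h3 : 1 ≤ (Fintype.card A + 1) ^ b := Nat.one_le_pow _ _ (Nat.succ_pos _)
    rw [pow_succ, mul_add, mul_one, mul_comm]
    rw [mul_comm] at h2 ⊢
    linarith

theorem card_listsUpTo_player (b : ℕ) : #(listsUpTo (Player × Bool) b) ≤ 9 ^ b :=
  card_listsUpTo_le _ b

/-- For inputs from a finite family, the coins of a protocol can be fixed without loss. -/
theorem HPCProtocol.Solves.exists_coins {n : ℕ} {π : HPCProtocol n} {x₁ : Fin n} {k : ℕ} {p : ℝ}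
    (h : π.Solves x₁ k p) {ι : Type*} [Fintype ι] [Nonempty ι] (I : ι → HPCInstance n) :
    ∃ c, p ≤ 𝔼 i, if π.run (I i).input c = (I i).pointer x₁ k then (1 : ℝ) else 0 := by
  have : MeasureTheory.IsProbabilityMeasure π.law := by
    unfold RandomizedProtocol.law
    infer_instance
  have hmeas : ∀ i, MeasurableSet {ω | π.run (I i).input ω = (I i).pointer x₁ k} := fun i =>
    π.measurable_run (I i).input
      (measurableSet_sum_iff.2 ⟨.of_discrete, .of_discrete⟩ :
        MeasurableSet {(I i).pointer x₁ k})
  have hint : ∀ i, MeasureTheory.Integrable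
      ({ω | π.run (I i).input ω = (I i).pointer x₁ k}.indicator fun _ => (1 : ℝ)) π.law :=
    fun i => (MeasureTheory.integrable_const 1).indicator (hmeas i)
  have hsum : ∫ ω, ∑ i, {ω | π.run (I i).input ω = (I i).pointer x₁ k}.indicator
      (fun _ => (1 : ℝ)) ω ∂π.law
        = ∑ i, π.law.real {ω | π.run (I i).input ω = (I i).pointer x₁ k} := by
    rw [MeasureTheory.integral_finsetSum _ fun i _ => hint i]
    refine sum_congr rfl fun i _ => ?_
    rw [MeasureTheory.integral_indicator_const _ (hmeas i)]
    simp
  obtain ⟨c, hc⟩ := MeasureTheory.exists_integral_le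
    (MeasureTheory.integrable_finsetSum univ fun i _ => hint i)
  refine ⟨c, ?_⟩
  rw [Fintype.expect_eq_sum_div_card, le_div_iff₀ (by exact_mod_cast Fintype.card_pos)]
  have h1 : ∑ i : ι, p ≤ ∑ i, π.law.real {ω | π.run (I i).input ω = (I i).pointer x₁ k} :=
    sum_le_sum fun i _ => h (I i)
  rw [sum_const, card_univ, nsmul_eq_mul] at h1
  rw [hsum] at hc
  calc _ = (Fintype.card ι : ℝ) * p := mul_comm _ _
    _ ≤ _ := h1.trans hc
    _ = _ := sum_congr rfl fun i _ => by simp [Set.indicator_apply]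

/-! ### A single set intersection instance -/

theorem HPCInstance.fAB_eq {n : ℕ} (I : HPCInstance n) {x t : Fin n} (h : I.A x ∩ I.B x = {t}) :
    I.fAB x = t := by
  have := (I.exists_target_AB x).choose_spec
  exact (singleton_injective (h.symm.trans this)).symm

theorem HPCInstance.fCD_eq {n : ℕ} (I : HPCInstance n) {y t : Fin n} (h : I.C y ∩ I.D y = {t}) :
    I.fCD y = t := by
  have := (I.exists_target_CD y).choose_spec
  exact (singleton_injective (h.symm.trans this)).symm

/-- The first player of each group. -/
def Player.isFirst : Player → Bool
  | .PA => true
  | .PB => false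
  | .PC => true
  | .PD => false

/-- The inputs of all players, from those of the two players of the group `g` and those of the two
players of the other group. -/
def groupInput {S : Type*} (g : PlayerGroup) (own other : Bool → S) (i : Player) : S :=
  if i.group = g then own i.isFirst else other i.isFirst

theorem groupInput_other {S : Type*} (g : PlayerGroup) (own other : Bool → S) :
    groupInput g.other own other = groupInput g other own := by
  funext i
  unfold groupInput
  by_cases h : i.group = g
  · rw [if_neg, if_pos h]
    rw [h]; exact PlayerGroup.ne_iff.2 (PlayerGroup.other_other g).symm
  · rw [if_pos (PlayerGroup.ne_iff.1 h), if_neg h]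

/-- The pointers, with the two universes identified, when the group `g` computes the function
`F g`. -/
def groupPointer {Y : Type*} (F : PlayerGroup → Y → Y) (x₁ : Y) : ℕ → Y
  | 0 => x₁
  | j + 1 => F (PlayerGroup.AB.alternate j) (groupPointer F x₁ j)

/-- The pointers do not notice a change of one function outside the points they visit. -/
theorem groupPointer_congr {Y : Type*} (F : PlayerGroup → Y → Y) (x₁ : Y) (g : PlayerGroup)
    (t : Y → Y) (j : ℕ) (h : ∀ i < j, F g (groupPointer F x₁ i) = t (groupPointer F x₁ i)) :
    ∀ i ≤ j, groupPointer (Function.update F g t) x₁ i = groupPointer F x₁ i := by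
  intro i hi
  induction i with
  | zero => rfl
  | succ i ih =>
    simp only [groupPointer]
    rw [ih (by omega)]
    by_cases hg : PlayerGroup.AB.alternate i = g
    · rw [hg, Function.update_self, h i (by omega)]
    · rw [Function.update_of_ne hg]

theorem HPCInstance.pointer_eq {n : ℕ} (I : HPCInstance n) (F : PlayerGroup → Fin n → Fin n)
    (hA : ∀ x, I.fAB x = F .AB x) (hC : ∀ y, I.fCD y = F .CD y) (x₁ : Fin n) (j : ℕ) :
    (PlayerGroup.AB.alternate j = .AB ∧ I.pointer x₁ j = .inl (groupPointer F x₁ j)) ∨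
      (PlayerGroup.AB.alternate j = .CD ∧ I.pointer x₁ j = .inr (groupPointer F x₁ j)) := by
  induction j with
  | zero => exact Or.inl ⟨rfl, rfl⟩
  | succ j ih =>
    rcases ih with ⟨h1, h2⟩ | ⟨h1, h2⟩
    · right
      simp only [PlayerGroup.alternate, HPCInstance.pointer, h1, h2, groupPointer, hA]
      exact ⟨rfl, trivial⟩
    · left
      simp only [PlayerGroup.alternate, HPCInstance.pointer, h1, h2, groupPointer, hC]
      exact ⟨rfl, trivial⟩

theorem HPCInstance.elim_pointer {n : ℕ} (I : HPCInstance n) (F : PlayerGroup → Fin n → Fin n)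
    (hA : ∀ x, I.fAB x = F .AB x) (hC : ∀ y, I.fCD y = F .CD y) (x₁ : Fin n) (j : ℕ) :
    (I.pointer x₁ j).elim id id = groupPointer F x₁ j := by
  rcases I.pointer_eq F hA hC x₁ j with ⟨_, h⟩ | ⟨_, h⟩ <;> rw [h] <;> rfl

theorem expect_eq_indicator {Y : Type*} [Fintype Y] [DecidableEq Y] (a : Y) :
    𝔼 u, (if a = u then (1 : ℝ) else 0) = 1 / Fintype.card Y := by
  rw [Fintype.expect_eq_sum_div_card]
  simp

section Single

variable {n : ℕ}

/-- The inputs of the two players of a group, the first of whom has `A` and the second `B`. -/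
def pairSets {S : Type*} (A B : S) (b : Bool) : S := if b then A else B

/-- A single set intersection instance as an instance of hidden-pointer chasing: all pairs
`(A x, B x)` are equal, and the pairs `(C y, D y)` encode the identity. -/
def singleInstance (α : Gadget Unit (Fin n)) : HPCInstance n where
  A _ := α.setA ()
  B _ := α.setB ()
  C y := {y}
  D y := {y}
  exists_target_AB _ := ⟨α.1 (), α.setA_inter_setB ()⟩
  exists_target_CD y := ⟨y, inter_self _⟩

theorem singleInstance_input (α : Gadget Unit (Fin n)) :
    (singleInstance α).input = groupInput .AB
      (pairSets (fun _ => α.setA ()) (fun _ => α.setB ())) fun _ y => {y} := by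
  funext i
  cases i <;> rfl

theorem elim_singleInstance_pointer (α : Gadget Unit (Fin n)) (x₁ : Fin n) (j : ℕ) :
    ((singleInstance α).pointer x₁ (j + 1)).elim id id = α.1 () := by
  set F : PlayerGroup → Fin n → Fin n := fun g y => match g with
    | .AB => α.1 ()
    | .CD => y
  rw [(singleInstance α).elim_pointer F (fun x => HPCInstance.fAB_eq _ (α.setA_inter_setB ()))
    (fun y => HPCInstance.fCD_eq _ (inter_self _))]
  induction j with
  | zero => rfl
  | succ j ih =>
    rw [groupPointer]
    rcases h : PlayerGroup.AB.alternate (j + 1) with _ | _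
    · rfl
    · exact ih

theorem groupInput_mix {S : Type*} (g : PlayerGroup) {A A' B B' : S} (o : Bool → S) (i : Player) :
    groupInput g (pairSets A' B) o i = groupInput g (pairSets A B) o i ∨
      groupInput g (pairSets A' B) o i = groupInput g (pairSets A' B') o i := by
  unfold groupInput pairSets
  split_ifs <;> simp

/-- Success probability of finding the intersection of a single pair of sets when only `N`
transcripts are possible. -/
theorem le_of_solves_single (π : HPCProtocol n) (x₁ : Fin n) (k : ℕ) (hk : 1 ≤ k) (p : ℝ)
    (hπ : π.Solves x₁ k p) (N : ℕ)
    (hN : ∀ c, ∃ s : Finset (List (Player × Bool)), #s ≤ N ∧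
      ∀ α : Gadget Unit (Fin n), π.transcript (singleInstance α).input c ∈ s) :
    p ≤ 1 / n + 20 * √(Real.log (N * (2 * n) : ℕ) / n) := by
  have : Nonempty (Fin n) := ⟨x₁⟩
  obtain ⟨j, rfl⟩ : ∃ j, k = j + 1 := ⟨k - 1, by omega⟩
  obtain ⟨c, hc⟩ := hπ.exists_coins (singleInstance (n := n))
  obtain ⟨s, hsN, hs⟩ := hN c
  let x : (Fin n → Finset (Fin n)) → (Fin n → Finset (Fin n)) → Player →
      Fin n → Finset (Fin n) := fun A B => groupInput .AB (pairSets A B) fun _ y => {y}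
  let R : (Unit → Fin n) → (Unit → Finset (Fin n)) → (Unit → Finset (Fin n)) →
      List (Player × Bool) × (Fin n ⊕ Fin n) := fun _ A B =>
    (π.transcript (x (fun _ => A ()) fun _ => B ()) c, π.run (x (fun _ => A ()) fun _ => B ()) c)
  have key := expect_test_target_le (X := Unit) (Y := Fin n) R
    (fun t A A' B B' h => by
      have hmix := fun i => groupInput_mix .AB (A := fun _ : Fin n => A ()) (A' := fun _ => A' ())
        (B := fun _ => B ()) (B' := fun _ => B' ()) (fun _ y => {y}) i
      have h1 := congrArg Prod.fst h
      have h2 := congrArg Prod.snd h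
      have hmix' : ∀ i, (groupInput .AB (pairSets (fun _ : Fin n => A' ()) (fun _ => B ()))
          (fun _ y => {y}) i, c.2 i) = _ ∨ _ = _ := fun i =>
        (hmix i).imp (fun e => congrArg (fun a => (a, c.2 i)) e)
          (fun e => congrArg (fun a => (a, c.2 i)) e)
      exact Prod.ext ((π.protocol c.1).transcript_eq_of_mix hmix' h1)
        ((π.protocol c.1).run_eq_of_mix hmix' h1 h2))
    (fun _ => s ×ˢ univ)
    (fun t D r => by
      have := hs (t, D, r)
      rw [singleInstance_input] at this
      exact mem_product.2 ⟨this, mem_univ _⟩)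
    (N * (2 * n))
    (fun t => by
      rw [card_product, card_univ, Fintype.card_sum, Fintype.card_fin, ← two_mul]
      exact Nat.mul_le_mul_right _ hsN)
    (fun _ => ∅) 0 (fun _ => by simp) (fun _ _ _ _ => rfl)
    (fun _ w u => if w.2.elim id id = u then 1 else 0)
    (fun _ w u => by split_ifs <;> norm_num) (fun _ w u => by split_ifs <;> norm_num)
  have : Nonempty (Gadget Unit (Fin n)) := ⟨(fun _ => x₁, fun _ => true, fun _ => true)⟩
  simp only [expect_sub_distrib, Fintype.expect_const, expect_eq_indicator, univ_unique,
    expect_singleton, Fintype.card_fin, Fintype.card_unit, one_mul, Nat.cast_zero, zero_div,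
    zero_add] at key
  have hle : 𝔼 α : Gadget Unit (Fin n), (if π.run (singleInstance α).input c
      = (singleInstance α).pointer x₁ (j + 1) then (1 : ℝ) else 0)
      ≤ 𝔼 α : Gadget Unit (Fin n),
        if (R α.1 α.setA α.setB).2.elim id id = α.1 () then 1 else 0 := by
    refine expect_le_expect fun α _ => ?_
    split_ifs with h1 h2 h2
    · exact le_rfl
    · refine absurd ?_ h2
      rw [← elim_singleInstance_pointer α x₁ j, ← h1, singleInstance_input]
    · exact zero_le_one
    · exact le_rfl
  have key' : _ - _ ≤ _ := key
  linarith [hc.trans hle]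

end Single

/-! ### The history of a pointer chasing protocol -/

section History

variable {n : ℕ}

/-- The two set families of a gadget. -/
def Gadget.sets (α : Gadget (Fin n) (Fin n)) : Bool → Fin n → Finset (Fin n) :=
  pairSets α.setA α.setB

/-- The two pointer functions, if that of the group `g` is `t` and that of the other is `t'`. -/
def groupTargets (g : PlayerGroup) (t t' : Fin n → Fin n) : PlayerGroup → Fin n → Fin n :=
  Function.update (fun _ => t') g t

theorem groupTargets_other (g : PlayerGroup) (t t' : Fin n → Fin n) :
    groupTargets g.other t t' = groupTargets g t' t := by
  funext h
  cases g <;> cases h <;> rfl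

@[simp] theorem groupTargets_self (g : PlayerGroup) (t t' : Fin n → Fin n) :
    groupTargets g t t' g = t := Function.update_self ..

theorem groupTargets_of_ne {g h : PlayerGroup} (t t' : Fin n → Fin n) (hg : h ≠ g) :
    groupTargets g t t' h = t' := Function.update_of_ne hg ..

/-- The instance of hidden-pointer chasing formed by a gadget for each group of players. -/
def gadgetInstance (α γ : Gadget (Fin n) (Fin n)) : HPCInstance n where
  A := α.setA
  B := α.setB
  C := γ.setA
  D := γ.setB
  exists_target_AB x := ⟨α.1 x, α.setA_inter_setB x⟩
  exists_target_CD y := ⟨γ.1 y, γ.setA_inter_setB y⟩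

theorem gadgetInstance_input (α γ : Gadget (Fin n) (Fin n)) :
    (gadgetInstance α γ).input = groupInput .AB α.sets γ.sets := by
  funext i
  cases i <;> rfl

theorem elim_gadgetInstance_pointer (α γ : Gadget (Fin n) (Fin n)) (x₁ : Fin n) (j : ℕ) :
    ((gadgetInstance α γ).pointer x₁ j).elim id id
      = groupPointer (groupTargets .AB α.1 γ.1) x₁ j :=
  HPCInstance.elim_pointer _ _ (fun x => HPCInstance.fAB_eq _ (α.setA_inter_setB x))
    (fun y => HPCInstance.fCD_eq _ (γ.setA_inter_setB y)) x₁ j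

/-- The instance in which the group `g` has the gadget `p` and the other group the gadget `q`. -/
def groupInstance (g : PlayerGroup) (p q : Gadget (Fin n) (Fin n)) : HPCInstance n :=
  match g with
  | .AB => gadgetInstance p q
  | .CD => gadgetInstance q p

theorem groupInstance_input (g : PlayerGroup) (p q : Gadget (Fin n) (Fin n)) :
    (groupInstance g p q).input = groupInput g p.sets q.sets := by
  cases g
  · exact gadgetInstance_input p q
  · exact (gadgetInstance_input q p).trans (groupInput_other .AB p.sets q.sets).symm

theorem elim_groupInstance_pointer (g : PlayerGroup) (p q : Gadget (Fin n) (Fin n)) (x₁ : Fin n)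
    (j : ℕ) : ((groupInstance g p q).pointer x₁ j).elim id id
      = groupPointer (groupTargets g p.1 q.1) x₁ j := by
  cases g
  · exact elim_gadgetInstance_pointer p q x₁ j
  · exact (elim_gadgetInstance_pointer q p x₁ j).trans
      (by rw [← groupTargets_other .AB]; rfl)

variable (π : HPCProtocol n) (c : π.Coins) (x₁ : Fin n)

/-- What is known about the data after phase `m + 1`, if the pointers are also announced as soon
as they can be computed: the messages of the first `m + 1` phases and the pointers
`z_0, …, z_m`. The group `g` has targets `t` and sets `A, B`, and the other group the gadget `q`. -/
def history (g : PlayerGroup) (m : ℕ) (q : Gadget (Fin n) (Fin n)) (t : Fin n → Fin n)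
    (A B : Fin n → Finset (Fin n)) : List (Player × Bool) × (ℕ → Fin n) :=
  ((π.protocol c.1).phasePrefix .CD m fun i => (groupInput g (pairSets A B) q.sets i, c.2 i),
    fun i => groupPointer (groupTargets g t q.1) x₁ (min i m))

/-- The history after phase `m + 1` for a pair of gadgets. -/
def gadgetHistory (g : PlayerGroup) (m : ℕ) (p q : Gadget (Fin n) (Fin n)) :
    List (Player × Bool) × (ℕ → Fin n) :=
  history π c x₁ g m q p.1 p.setA p.setB

variable {π c x₁}

theorem gadgetHistory_other (g : PlayerGroup) (m : ℕ) (p q : Gadget (Fin n) (Fin n)) :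
    gadgetHistory π c x₁ g.other m p q = gadgetHistory π c x₁ g m q p := by
  unfold gadgetHistory history
  rw [groupTargets_other]
  change ((π.protocol c.1).phasePrefix .CD m fun i => (groupInput g.other p.sets q.sets i, c.2 i),
    _) = _
  rw [groupInput_other]
  rfl

theorem isRectangular_history (g : PlayerGroup) (m : ℕ) (q : Gadget (Fin n) (Fin n))
    (t : Fin n → Fin n) : IsRectangular (history π c x₁ g m q t) := by
  intro A A' B B' h
  refine Prod.ext ((π.protocol c.1).phasePrefix_eq_of_mix _ _ (fun i => ?_)
    (congrArg Prod.fst h)) rfl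
  exact (groupInput_mix g q.sets i).imp (fun e => congrArg (fun a => (a, c.2 i)) e)
    (fun e => congrArg (fun a => (a, c.2 i)) e)

theorem groupPointer_eq_of_history {g : PlayerGroup} {m : ℕ} {p p' q q' : Gadget (Fin n) (Fin n)}
    (h : gadgetHistory π c x₁ g m p q = gadgetHistory π c x₁ g m p' q') {i : ℕ} (hi : i ≤ m) :
    groupPointer (groupTargets g p.1 q.1) x₁ i = groupPointer (groupTargets g p'.1 q'.1) x₁ i := by
  have := congrFun (congrArg Prod.snd h) i
  simpa only [gadgetHistory, history, min_eq_left hi] using this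

theorem isRectangular_gadgetHistory (g : PlayerGroup) (m : ℕ) :
    IsRectangular (gadgetHistory π c x₁ g m) := by
  intro p p' q q' h
  refine Prod.ext ((π.protocol c.1).phasePrefix_eq_of_mix _ _ (fun i => ?_)
    (congrArg Prod.fst h)) (funext fun i => ?_)
  · by_cases hi : i.group = g
    · right
      simp only [groupInput, if_pos hi]
    · left
      simp only [groupInput, if_neg hi]
  · have key : ∀ i ≤ m, groupPointer (groupTargets g p'.1 q.1) x₁ i
        = groupPointer (groupTargets g p.1 q.1) x₁ i := by
      intro i hi
      induction i with
      | zero => rfl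
      | succ i ih =>
        have ih' := ih (by omega)
        by_cases hg : PlayerGroup.AB.alternate i = g
        · rw [groupPointer_eq_of_history h hi]
          simp only [groupPointer]
          rw [ih', groupPointer_eq_of_history h (show i ≤ m by omega), hg, groupTargets_self,
            groupTargets_self]
        · simp only [groupPointer]
          rw [ih', groupTargets_of_ne _ _ hg, groupTargets_of_ne _ _ hg]
    exact key _ (min_le_right i m)

/-- If `g` computes `z_{m+2}`, the other group computes `z_{m+1}`. -/
theorem groupPointer_succ_of_eq_other {g : PlayerGroup} {m : ℕ}
    (hg : g = PlayerGroup.AB.alternate (m + 1)) (t t' : Fin n → Fin n) :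
    groupPointer (groupTargets g t t') x₁ (m + 1)
      = t' (groupPointer (groupTargets g t t') x₁ m) := by
  rw [groupPointer, groupTargets_of_ne]
  rw [PlayerGroup.ne_iff, hg, PlayerGroup.alternate, PlayerGroup.other_other]

theorem groupPointer_succ_congr {g : PlayerGroup} {m : ℕ}
    (hg : g = PlayerGroup.AB.alternate (m + 1)) {p p' q : Gadget (Fin n) (Fin n)}
    (h : gadgetHistory π c x₁ g m p q = gadgetHistory π c x₁ g m p' q) :
    groupPointer (groupTargets g p.1 q.1) x₁ (m + 1)
      = groupPointer (groupTargets g p'.1 q.1) x₁ (m + 1) := by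
  rw [groupPointer_succ_of_eq_other hg, groupPointer_succ_of_eq_other hg,
    groupPointer_eq_of_history h le_rfl]

/-- Phase `m + 2` belongs to the group that does not compute `z_{m+2}`. -/
theorem phasePrefix_succ_congr_of_history {g : PlayerGroup} {m : ℕ}
    (hg : g = PlayerGroup.AB.alternate (m + 1)) {p p' q : Gadget (Fin n) (Fin n)}
    (h : gadgetHistory π c x₁ g m p q = gadgetHistory π c x₁ g m p' q) :
    ((π.protocol c.1).phasePrefix .CD (m + 1) fun i => (groupInput g p.sets q.sets i, c.2 i))
      = (π.protocol c.1).phasePrefix .CD (m + 1)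
          fun i => (groupInput g p'.sets q.sets i, c.2 i) := by
  refine Protocol.phasePrefix_succ_congr _ _ _ (fun i hi => ?_) (congrArg Prod.fst h)
  have hi' : i.group ≠ g := by
    rw [PlayerGroup.ne_iff, hi, hg]
    exact PlayerGroup.alternate_other .AB (m + 1)
  simp only [groupInput, if_neg hi']

theorem gadgetHistory_succ_congr {g : PlayerGroup} {m : ℕ}
    (hg : g = PlayerGroup.AB.alternate (m + 1)) {p p' q : Gadget (Fin n) (Fin n)}
    (h : gadgetHistory π c x₁ g m p q = gadgetHistory π c x₁ g m p' q) :
    gadgetHistory π c x₁ g (m + 1) p q = gadgetHistory π c x₁ g (m + 1) p' q := by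
  refine Prod.ext (phasePrefix_succ_congr_of_history hg h) (funext fun i => ?_)
  have key : ∀ i ≤ m + 1, groupPointer (groupTargets g p.1 q.1) x₁ i
        = groupPointer (groupTargets g p'.1 q.1) x₁ i := by
    intro i hi
    rcases Nat.le_succ_iff.1 hi with hi | rfl
    · exact groupPointer_eq_of_history h hi
    · exact groupPointer_succ_congr hg h
  exact key _ (min_le_right i (m + 1))

/-- The history, together with further messages that take at most `|E|` values and respect
rectangles, says little about the target of a random instance. -/
theorem expect_test_history_le {b : ℕ} (hb : π.CostAtMost b) (g : PlayerGroup) (m : ℕ)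
    (q : Gadget (Fin n) (Fin n)) {E : Type*} [Fintype E]
    (h : List (Player × Bool) × (ℕ → Fin n) → (Fin n → Finset (Fin n)) →
      (Fin n → Finset (Fin n)) → E) (hh : ∀ w, IsRectangular (h w))
    (φ : Fin n → (List (Player × Bool) × (ℕ → Fin n)) × E → Fin n → ℝ)
    (hφ0 : ∀ x w y, 0 ≤ φ x w y) (hφ1 : ∀ x w y, φ x w y ≤ 1) :
    𝔼 x, 𝔼 p : Gadget (Fin n) (Fin n),
      (φ x (gadgetHistory π c x₁ g m p q, h (gadgetHistory π c x₁ g m p q) p.setA p.setB) (p.1 x)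
        - 𝔼 u, φ x (gadgetHistory π c x₁ g m p q,
          h (gadgetHistory π c x₁ g m p q) p.setA p.setB) u) ≤
      m / n + 20 * √(Real.log (9 ^ b * Fintype.card E : ℕ) / (n * n : ℕ)) := by
  classical
  have : Nonempty (Fin n) := ⟨x₁⟩
  have key := expect_test_target_le (X := Fin n) (Y := Fin n)
    (fun t A B => (history π c x₁ g m q t A B, h (history π c x₁ g m q t A B) A B))
    (fun t A A' B B' e => by
      have e1 := congrArg Prod.fst e
      have e2 := congrArg Prod.snd e
      dsimp only at e1 e2
      have e3 := isRectangular_history g m q t A A' B B' e1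
      rw [← e1] at e2
      refine Prod.ext e3 ?_
      dsimp only
      rw [e3]
      exact hh _ A A' B B' e2)
    (fun t => (listsUpTo (Player × Bool) b ×ˢ
      {fun i => groupPointer (groupTargets g t q.1) x₁ (min i m)}) ×ˢ univ)
    (fun t D r => by
      refine mem_product.2 ⟨mem_product.2 ⟨mem_listsUpTo ?_, mem_singleton_self _⟩, mem_univ _⟩
      have h1 := hb (groupInstance g (t, D, r) q) c
      rw [groupInstance_input] at h1
      exact (Protocol.length_phasePrefix_le _ _ _ _).trans h1)
    (9 ^ b * Fintype.card E)
    (fun t => by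
      rw [card_product, card_product, card_singleton, mul_one, card_univ]
      exact Nat.mul_le_mul_right _ (card_listsUpTo_player b))
    (fun t => (range m).image (groupPointer (groupTargets g t q.1) x₁)) m
    (fun t => card_image_le.trans (card_range m).le)
    (fun t x hx i => by
      -- The pointers change only if `x` is one of the points that they visit.
      have hpath : ∀ j ≤ m, groupPointer (groupTargets g (Function.update t x i) q.1) x₁ j
          = groupPointer (groupTargets g t q.1) x₁ j := by
        have e : groupTargets g (Function.update t x i) q.1
            = Function.update (groupTargets g t q.1) g (Function.update t x i) := by
          unfold groupTargets
          rw [Function.update_idem]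
        rw [e]
        refine groupPointer_congr _ _ _ _ _ fun j hj => ?_
        rw [groupTargets_self, Function.update_of_ne]
        rintro e
        exact hx (mem_image.2 ⟨j, mem_range.2 hj, e⟩)
      have hhist : history π c x₁ g m q (Function.update t x i) = history π c x₁ g m q t := by
        funext A B
        exact Prod.ext rfl (funext fun j => hpath _ (min_le_right j m))
      rw [hhist])
    φ hφ0 hφ1
  simp only [Fintype.card_fin] at key
  exact key

theorem isNearUniform_gadgetHistory_alternate {g : PlayerGroup} {m : ℕ}
    (hg : g = PlayerGroup.AB.alternate (m + 1)) {δ : ℝ}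
    (h : IsNearUniform (gadgetHistory π c x₁ (PlayerGroup.AB.alternate m) m)
      (fun p q => groupPointer
        (groupTargets (PlayerGroup.AB.alternate m) p.1 q.1) x₁ (m + 1)) δ) :
    IsNearUniform (gadgetHistory π c x₁ g m)
      (fun p q => groupPointer (groupTargets g p.1 q.1) x₁ (m + 1)) δ := by
  have hg' : PlayerGroup.AB.alternate m = g.other := by
    rw [hg, PlayerGroup.alternate, PlayerGroup.other_other]
  have h' := h.swap
  rw [hg'] at h'
  simpa only [gadgetHistory_other, groupTargets_other] using h'

/-- Before phase `m + 2`, the pointer `z_{m+1}` is close to uniform given the history. -/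
theorem isNearUniform_gadgetHistory {b : ℕ} (hb : π.CostAtMost b) (k m : ℕ) (hm : m ≤ k) :
    IsNearUniform (gadgetHistory π c x₁ (PlayerGroup.AB.alternate m) m)
      (fun p q => groupPointer
        (groupTargets (PlayerGroup.AB.alternate m) p.1 q.1) x₁ (m + 1))
      (m * (k / n + 20 * √(Real.log (9 ^ b : ℕ) / (n * n : ℕ)))) := by
  classical
  have : Nonempty (Fin n) := ⟨x₁⟩
  induction m with
  | zero =>
    -- The first phase does not depend on the data that determine `z_1`.
    have hconst : ∀ p p' q, gadgetHistory π c x₁ .AB 0 p q = gadgetHistory π c x₁ .AB 0 p' q := by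
      intro p p' q
      refine Prod.ext (Protocol.phasePrefix_zero_congr _ _ fun i hi => ?_) (funext fun i => ?_)
      · simp only [groupInput, hi, reduceCtorEq, if_false]
      · simp only [gadgetHistory, history, Nat.min_zero]
        rfl
    intro ψ h0 h1
    rw [Nat.cast_zero, zero_mul, add_zero]
    refine le_of_eq ?_
    change 𝔼 p : Gadget (Fin n) (Fin n), 𝔼 q : Gadget (Fin n) (Fin n),
      ψ (gadgetHistory π c x₁ .AB 0 p q) (p.1 x₁) = 𝔼 p : Gadget (Fin n) (Fin n),
        𝔼 q : Gadget (Fin n) (Fin n), 𝔼 y, ψ (gadgetHistory π c x₁ .AB 0 p q) y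
    obtain ⟨p₀⟩ : Nonempty (Gadget (Fin n) (Fin n)) :=
      ⟨(fun _ => x₁, fun _ => true, fun _ => true)⟩
    rw [expect_comm, expect_comm univ univ
      (fun p q => 𝔼 y, ψ (gadgetHistory π c x₁ .AB 0 p q) y)]
    refine expect_congr rfl fun q _ => ?_
    simp only [fun p => hconst p p₀ q]
    rw [expect_gadget]
    simp only [Fintype.expect_const]
    have := expect_target_swap (X := Fin n) (Y := Fin n) x₁
      (fun t _ => ψ (gadgetHistory π c x₁ .AB 0 p₀ q) (t x₁))
    simpa only [Fintype.expect_const, Function.update_self] using this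
  | succ m ih =>
    set g := PlayerGroup.AB.alternate (m + 1) with hg
    have h1 := isNearUniform_gadgetHistory_alternate hg (ih (by omega))
    have h2 := IsNearUniform.step (W := gadgetHistory π c x₁ g m)
      (W' := gadgetHistory π c x₁ g (m + 1))
      (z := fun p q => groupPointer (groupTargets g p.1 q.1) x₁ (m + 1))
      (isRectangular_gadgetHistory g m)
      (fun p p' q e => gadgetHistory_succ_congr hg e)
      (fun p p' q e => groupPointer_succ_congr hg e) h1 (fun p => p.1)
      (ε := k / n + 20 * √(Real.log (9 ^ b : ℕ) / (n * n : ℕ)))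
      (fun φ h0 h1 => by
        have e1 : ∀ x, 𝔼 p : Gadget (Fin n) (Fin n), 𝔼 q : Gadget (Fin n) (Fin n),
            (φ x (gadgetHistory π c x₁ g m p q) (p.1 x)
              - 𝔼 u, φ x (gadgetHistory π c x₁ g m p q) u)
            = 𝔼 q : Gadget (Fin n) (Fin n), 𝔼 p : Gadget (Fin n) (Fin n),
            (φ x (gadgetHistory π c x₁ g m p q) (p.1 x)
              - 𝔼 u, φ x (gadgetHistory π c x₁ g m p q) u) := fun x => expect_comm _ _ _
        simp only [e1]
        rw [expect_comm]
        have : Nonempty (Gadget (Fin n) (Fin n)) :=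
          ⟨(fun _ => x₁, fun _ => true, fun _ => true)⟩
        refine expect_le univ_nonempty fun q _ => ?_
        have key := expect_test_history_le (c := c) (x₁ := x₁) hb g m q
          (fun _ _ _ => ()) (fun _ _ _ _ _ _ => rfl)
          (fun x w y => φ x w.1 y) (fun _ _ _ => h0 _ _ _) (fun _ _ _ => h1 _ _ _)
        rw [Fintype.card_unit, mul_one] at key
        refine key.trans ?_
        gcongr
        omega)
    have e : (fun p q : Gadget (Fin n) (Fin n) =>
        groupPointer (groupTargets g p.1 q.1) x₁ (m + 1 + 1))
        = fun p q => p.1 (groupPointer (groupTargets g p.1 q.1) x₁ (m + 1)) := by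
      funext p q
      rw [groupPointer, ← hg, groupTargets_self]
    rw [e]
    have e2 : ((m + 1 : ℕ) : ℝ) * (k / n + 20 * √(Real.log (9 ^ b : ℕ) / (n * n : ℕ)))
        = m * (k / n + 20 * √(Real.log (9 ^ b : ℕ) / (n * n : ℕ)))
          + (k / n + 20 * √(Real.log (9 ^ b : ℕ) / (n * n : ℕ))) := by
      push_cast; ring
    rw [e2]
    exact h2

end History

/-! ### Guessing the last pointer -/

section Guess

variable {n : ℕ} {π : HPCProtocol n} {c : π.Coins} {x₁ : Fin n}

/-- A way to answer for one of the two players of a group: the choice of the player and a function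
of the sets of this player. -/
abbrev Guesser (n : ℕ) : Type := Bool × ((Fin n → Finset (Fin n)) → Fin n ⊕ Fin n)

/-- The answer on the sets `A` of the first and `B` of the second player, with the two universes
identified. -/
def Guesser.guess (η : Guesser n) (A B : Fin n → Finset (Fin n)) : Fin n :=
  (η.2 (pairSets A B η.1)).elim id id

theorem isRectangular_guess {ι : Type*} (η : ι → Guesser n) :
    IsRectangular fun A B => fun x => (η x).guess A B := by
  intro A A' B B' e
  funext x
  have ex := congrFun e x
  simp only [Guesser.guess] at ex ⊢
  rcases h : (η x).1 with _ | _
  · simp only [pairSets, Bool.false_eq_true, if_false]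
  · simp only [h, pairSets, if_true] at ex ⊢
    exact ex.symm

/-- Given the history and the data of the other group, the answer is that of a guesser. -/
theorem exists_guesser_of_isPhase {m : ℕ} (hphase : π.IsPhase (m + 2)) {g : PlayerGroup}
    (hg : g = PlayerGroup.AB.alternate (m + 1)) (p q : Gadget (Fin n) (Fin n)) :
    ∃ η : Guesser n, ∀ p' : Gadget (Fin n) (Fin n),
      gadgetHistory π c x₁ g m p' q = gadgetHistory π c x₁ g m p q →
      π.run (groupInstance g p' q).input c = η.2 (p'.sets η.1) := by
  obtain ⟨i, a, ha⟩ := (π.protocol c.1).exists_run_eq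
    (fun i => (groupInput g p.sets q.sets i, c.2 i))
  have htr : ∀ p' : Gadget (Fin n) (Fin n),
      gadgetHistory π c x₁ g m p' q = gadgetHistory π c x₁ g m p q →
      π.run (groupInstance g p' q).input c = a (groupInput g p'.sets q.sets i, c.2 i) := by
    intro p' hp'
    rw [groupInstance_input]
    refine ha _ ?_
    have e : ∀ p : Gadget (Fin n) (Fin n), (π.protocol c.1).phasePrefix .CD (m + 1)
        (fun i => (groupInput g p.sets q.sets i, c.2 i))
        = (π.protocol c.1).transcript fun i => (groupInput g p.sets q.sets i, c.2 i) := by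
      intro p
      have := hphase (groupInstance g p q) c
      rw [groupInstance_input] at this
      exact Protocol.phasePrefix_eq_transcript _ _ _ _ this
    rw [← e, ← e]
    exact phasePrefix_succ_congr_of_history hg hp'
  by_cases hi : i.group = g
  · refine ⟨(i.isFirst, fun s => a (s, c.2 i)), fun p' hp' => ?_⟩
    rw [htr p' hp']
    simp only [groupInput, if_pos hi]
  · refine ⟨(true, fun _ => a (q.sets i.isFirst, c.2 i)), fun p' hp' => ?_⟩
    rw [htr p' hp']
    simp only [groupInput, if_neg hi]

/-- The target at a random point is hard to guess, even for guessers that depend on the history: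
the guesses for all points, announced by the group `g`, are `n` further messages. -/
theorem expect_guess_le {b : ℕ} (hb : π.CostAtMost b) (g : PlayerGroup) (m : ℕ)
    (best : List (Player × Bool) × (ℕ → Fin n) → Fin n → Guesser n) :
    𝔼 y, 𝔼 p : Gadget (Fin n) (Fin n), 𝔼 q : Gadget (Fin n) (Fin n),
      (if (best (gadgetHistory π c x₁ g m p q) y).guess p.setA p.setB = p.1 y
        then (1 : ℝ) else 0)
      ≤ 1 / n + (m / n + 20 * √(Real.log (9 ^ b * n ^ n : ℕ) / (n * n : ℕ))) := by
  have : Nonempty (Fin n) := ⟨x₁⟩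
  have : Nonempty (Gadget (Fin n) (Fin n)) := ⟨(fun _ => x₁, fun _ => true, fun _ => true)⟩
  have e1 : ∀ y, 𝔼 p : Gadget (Fin n) (Fin n), 𝔼 q : Gadget (Fin n) (Fin n),
      (if (best (gadgetHistory π c x₁ g m p q) y).guess p.setA p.setB = p.1 y
        then (1 : ℝ) else 0)
      = 𝔼 q : Gadget (Fin n) (Fin n), 𝔼 p : Gadget (Fin n) (Fin n),
      (if (best (gadgetHistory π c x₁ g m p q) y).guess p.setA p.setB = p.1 y
        then (1 : ℝ) else 0) :=
    fun y => expect_comm _ _ _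
  simp only [e1]
  rw [expect_comm]
  refine expect_le univ_nonempty fun q _ => ?_
  have key := expect_test_history_le (c := c) (x₁ := x₁) hb g m q (E := Fin n → Fin n)
    (fun w A B x => (best w x).guess A B)
    (fun w => isRectangular_guess (best w))
    (fun x w u => if w.2 x = u then 1 else 0)
    (fun _ _ _ => by split_ifs <;> norm_num) (fun _ _ _ => by split_ifs <;> norm_num)
  simp only [expect_sub_distrib, expect_eq_indicator, Fintype.expect_const, Fintype.card_pi,
    prod_const, card_univ, Fintype.card_fin] at key
  exact sub_le_iff_le_add'.1 key

/-- Success probability of chasing at least two pointers. -/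
theorem le_of_solves_of_isPhase (π : HPCProtocol n) (x₁ : Fin n) (m : ℕ) (p : ℝ)
    (hphase : π.IsPhase (m + 2)) (hπ : π.Solves x₁ (m + 2) p) (b : ℕ) (hb : π.CostAtMost b) :
    p ≤ 1 / n + (m / n + 20 * √(Real.log (9 ^ b * n ^ n : ℕ) / (n * n : ℕ)))
      + m * ((m : ℝ) / n + 20 * √(Real.log (9 ^ b : ℕ) / (n * n : ℕ))) := by
  have : Nonempty (Fin n) := ⟨x₁⟩
  have : Nonempty (Gadget (Fin n) (Fin n)) := ⟨(fun _ => x₁, fun _ => true, fun _ => true)⟩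
  have : Nonempty (Guesser n) := ⟨(true, fun _ => .inl x₁)⟩
  obtain ⟨g, hg⟩ : ∃ g, g = PlayerGroup.AB.alternate (m + 1) := ⟨_, rfl⟩
  obtain ⟨c, hc⟩ := hπ.exists_coins
    (fun w : Gadget (Fin n) (Fin n) × Gadget (Fin n) (Fin n) => groupInstance g w.1 w.2)
  rw [← univ_product_univ, expect_product] at hc
  have hδ := isNearUniform_gadgetHistory_alternate (π := π) (c := c) (x₁ := x₁) hg
    (isNearUniform_gadgetHistory hb m m le_rfl)
  -- The guesser is chosen as a function of the history and of `q` only.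
  let θ : Gadget (Fin n) (Fin n) → Gadget (Fin n) (Fin n) → Guesser n := fun p q =>
    Classical.epsilon fun η : Guesser n => ∀ p' : Gadget (Fin n) (Fin n),
      gadgetHistory π c x₁ g m p' q = gadgetHistory π c x₁ g m p q →
      π.run (groupInstance g p' q).input c = η.2 (p'.sets η.1)
  have hθ : ∀ p q, π.run (groupInstance g p q).input c = (θ p q).2 (p.sets (θ p q).1) :=
    fun p q => Classical.epsilon_spec (exists_guesser_of_isPhase hphase hg p q) p rfl
  obtain ⟨best, hbest⟩ := IsNearUniform.exists_guess (H := Guesser n)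
    (W := gadgetHistory π c x₁ g m)
    (z := fun p q => groupPointer (groupTargets g p.1 q.1) x₁ (m + 1))
    (isRectangular_gadgetHistory g m)
    (fun p p' q e => groupPointer_succ_congr hg e) hδ (fun p => p.1)
    (fun η p => η.guess p.setA p.setB)
  have h1 := hbest θ (fun p p' q e => by simp only [θ, e])
  have h2 : 𝔼 p : Gadget (Fin n) (Fin n), 𝔼 q : Gadget (Fin n) (Fin n),
      (if π.run (groupInstance g p q).input c = (groupInstance g p q).pointer x₁ (m + 2)
        then (1 : ℝ) else 0)
      ≤ 𝔼 p : Gadget (Fin n) (Fin n), 𝔼 q : Gadget (Fin n) (Fin n),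
        (if (θ p q).guess p.setA p.setB
            = p.1 (groupPointer (groupTargets g p.1 q.1) x₁ (m + 1))
          then (1 : ℝ) else 0) := by
    refine expect_le_expect fun p _ => expect_le_expect fun q _ => ?_
    split_ifs with e1 e2 e2
    · exact le_rfl
    · refine absurd ?_ e2
      have e3 := elim_groupInstance_pointer g p q x₁ (m + 2)
      rw [← e1, hθ, groupPointer, ← hg, groupTargets_self] at e3
      exact e3
    · exact zero_le_one
    · exact le_rfl
  have h3 := expect_guess_le (c := c) (x₁ := x₁) hb g m best
  exact (hc.trans h2).trans (h1.trans (by linarith))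

end Guess

/-! ### The bounds on the cost -/

theorem tendsto_guess_error :
    Filter.Tendsto (fun n : ℕ => 1 / (n : ℝ) + 20 * √(Real.log (2 * n) / n)) Filter.atTop
      (nhds 0) := by
  have h1 : Filter.Tendsto (fun n : ℕ => 1 / (n : ℝ)) Filter.atTop (nhds 0) :=
    tendsto_one_div_atTop_nhds_zero_nat
  have h2 : Filter.Tendsto (fun n : ℕ => Real.log (2 * n) / n) Filter.atTop (nhds 0) := by
    have h3 : Filter.Tendsto (fun n : ℕ => (2 : ℝ) * n) Filter.atTop Filter.atTop :=
      tendsto_natCast_atTop_atTop.const_mul_atTop (by norm_num)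
    have h4 := (Real.tendsto_pow_log_div_mul_add_atTop (1 / 2) 0 1 (by norm_num)).comp h3
    refine h4.congr fun n => ?_
    simp
  have h5 := (Real.continuous_sqrt.tendsto 0).comp h2
  have h6 := h1.add (h5.const_mul 20)
  simpa using h6

theorem sqrt_add_le_sqrt_add_sqrt {x y : ℝ} (hx : 0 ≤ x) (hy : 0 ≤ y) : √(x + y) ≤ √x + √y := by
  rw [Real.sqrt_le_iff]
  refine ⟨by positivity, ?_⟩
  nlinarith [Real.sq_sqrt hx, Real.sq_sqrt hy,
    mul_nonneg (Real.sqrt_nonneg x) (Real.sqrt_nonneg y)]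

theorem log_nine_pow_le (b : ℕ) : Real.log (9 ^ b : ℕ) ≤ 9 * b := by
  have : Real.log 9 ≤ 9 := (Real.log_le_sub_one_of_pos (by norm_num)).trans (by norm_num)
  push_cast
  rw [Real.log_pow, mul_comm]
  exact mul_le_mul_of_nonneg_right this (Nat.cast_nonneg b)

/-- Finding a single intersection takes a linear number of bits, however many phases are used. -/
theorem linear_le_cost {n : ℕ} (π : HPCProtocol n) (x₁ : Fin n) (k : ℕ) (hk : 1 ≤ k) {p : ℝ}
    (hp : 0 < p) (hπ : π.Solves x₁ k p) (b : ℕ) (hb : π.CostAtMost b)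
    (hn : 1 / (n : ℝ) + 20 * √(Real.log (2 * n) / n) ≤ p / 2) :
    (p / 120) ^ 2 * n ≤ b := by
  have hnpos : 0 < n := x₁.pos
  have hn0 : (0 : ℝ) < n := by exact_mod_cast hnpos
  have h := le_of_solves_single π x₁ k hk p hπ (9 ^ b) fun c =>
    ⟨listsUpTo (Player × Bool) b, card_listsUpTo_player b, fun α =>
      mem_listsUpTo (hb (singleInstance α) c)⟩
  have h9 := log_nine_pow_le b
  have h1 : √(Real.log (9 ^ b * (2 * n) : ℕ) / n) ≤ 3 * √(b / n) + √(Real.log (2 * n) / n) := by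
    have e : (3 : ℝ) * √(b / n) = √(9 * b / n) := by
      rw [mul_div_assoc, Real.sqrt_mul (by norm_num), show (9 : ℝ) = 3 ^ 2 by norm_num,
        Real.sqrt_sq (by norm_num)]
    rw [e]
    refine le_trans (Real.sqrt_le_sqrt ?_) (sqrt_add_le_sqrt_add_sqrt (by positivity) ?_)
    · rw [← add_div]
      refine div_le_div_of_nonneg_right ?_ hn0.le
      rw [Nat.cast_mul, Real.log_mul (by positivity) (by positivity)]
      push_cast at h9 ⊢
      linarith
    · have : (1 : ℝ) ≤ n := by exact_mod_cast x₁.pos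
      exact div_nonneg (Real.log_nonneg (by linarith)) hn0.le
  have h2 : p / 120 ≤ √(b / n) := by linarith
  have h3 := (Real.le_sqrt' (by positivity)).1 h2
  rwa [le_div_iff₀ hn0] at h3

/-- After one phase nothing is known about the sets that determine `z_1`. -/
theorem not_solves_one_phase {n : ℕ} (π : HPCProtocol n) (x₁ : Fin n) {p : ℝ}
    (hphase : π.IsPhase 1) (hπ : π.Solves x₁ 1 p)
    (hn : 1 / (n : ℝ) + 20 * √(Real.log (2 * n) / n) < p) : False := by
  -- The players `P_C` and `P_D` have a fixed input, so that there is only one transcript.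
  have h := le_of_solves_single π x₁ 1 le_rfl p hπ 1 fun c => by
    let α₀ : Gadget Unit (Fin n) := (fun _ => x₁, fun _ => true, fun _ => true)
    refine ⟨{π.transcript (singleInstance α₀).input c}, (card_singleton _).le, fun α => ?_⟩
    rw [mem_singleton]
    have e : ∀ α, (π.protocol c.1).phasePrefix .CD 0
        (fun i => ((singleInstance α).input i, c.2 i))
        = π.transcript (singleInstance α).input c := fun α =>
      Protocol.phasePrefix_eq_transcript _ _ _ _ (hphase (singleInstance α) c)
    rw [← e, ← e]
    refine Protocol.phasePrefix_zero_congr _ _ fun i hi => ?_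
    rw [singleInstance_input, singleInstance_input]
    simp only [groupInput, hi, reduceCtorEq, if_false]
  rw [one_mul] at h
  push_cast at h
  linarith

/-- For few phases, the errors of the phases add up to less than `p` unless the number of bits is
quadratic in `n / k`. -/
theorem quadratic_le_cost {n : ℕ} (π : HPCProtocol n) (x₁ : Fin n) (k : ℕ) (hk : 1 ≤ k) {p : ℝ}
    (hp : 0 < p) (hphase : π.IsPhase k) (hπ : π.Solves x₁ k p) (b : ℕ) (hb : π.CostAtMost b)
    (hn : 1 / (n : ℝ) + 20 * √(Real.log (2 * n) / n) ≤ p / 4) (hkn : (k : ℝ) ^ 2 ≤ p / 4 * n) :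
    (p / 120) ^ 2 * ((n : ℝ) ^ 2 / (k : ℝ) ^ 2) ≤ b := by
  obtain rfl | ⟨m, rfl⟩ : k = 1 ∨ ∃ m, k = m + 2 := by
    rcases hk.eq_or_lt with h | h
    · exact Or.inl h.symm
    · exact Or.inr ⟨k - 2, by omega⟩
  · exact (not_solves_one_phase π x₁ hphase hπ (by linarith)).elim
  have hnpos : 0 < n := x₁.pos
  have hn1 : (1 : ℝ) ≤ n := by exact_mod_cast hnpos
  have hn0 : (0 : ℝ) < n := by linarith
  have h := le_of_solves_of_isPhase π x₁ m p hphase hπ b hb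
  have h9 := log_nine_pow_le b
  have e1 : ∀ L : ℝ, √(L / (n * n : ℕ)) = √L / n := by
    intro L
    rw [Nat.cast_mul, Real.sqrt_div' _ (by positivity), Real.sqrt_mul_self hn0.le]
  have e2 : (3 : ℝ) * √b = √(9 * b) := by
    rw [Real.sqrt_mul (by norm_num), show (9 : ℝ) = 3 ^ 2 by norm_num, Real.sqrt_sq (by norm_num)]
  have h1 : √(Real.log (9 ^ b : ℕ) / (n * n : ℕ)) ≤ 3 * √b / n := by
    rw [e1, e2]
    exact div_le_div_of_nonneg_right (Real.sqrt_le_sqrt h9) hn0.le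
  have h2 : √(Real.log (9 ^ b * n ^ n : ℕ) / (n * n : ℕ))
      ≤ 3 * √b / n + √(Real.log (2 * n) / n) := by
    have e3 : √(Real.log (2 * n) / n) = √(n * Real.log (2 * n)) / n := by
      rw [← e1]
      congr 1
      push_cast
      field_simp
    rw [e3, ← add_div, e1, e2]
    refine div_le_div_of_nonneg_right ?_ hn0.le
    refine le_trans (Real.sqrt_le_sqrt ?_) (sqrt_add_le_sqrt_add_sqrt (by positivity) ?_)
    · rw [Nat.cast_mul, Real.log_mul (by positivity) (by positivity)]
      have h3 : Real.log (n ^ n : ℕ) ≤ n * Real.log (2 * n) := by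
        push_cast
        rw [Real.log_pow]
        exact mul_le_mul_of_nonneg_left (Real.log_le_log hn0 (by linarith)) hn0.le
      linarith
    · exact mul_nonneg hn0.le (Real.log_nonneg (by linarith))
  have hm : (0 : ℝ) ≤ m := Nat.cast_nonneg m
  push_cast at hkn ⊢
  have h4 : (m : ℝ) / n + m * (m / n) ≤ p / 4 := by
    have : (m : ℝ) / n + m * (m / n) = (m + m ^ 2) / n := by field_simp
    rw [this, div_le_iff₀ hn0]
    nlinarith
  have h5 := mul_le_mul_of_nonneg_left h1 hm
  have h6 : 0 ≤ √(b : ℝ) / n := by positivity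
  have e4 : 3 * √(b : ℝ) / n = 3 * (√b / n) := mul_div_assoc ..
  rw [e4] at h2 h5
  have h7 : p / 2 ≤ 60 * (m + 2) * (√b / n) := by nlinarith
  have h8 : p / 120 * (n / (m + 2)) ≤ √b := by
    rw [← mul_div_assoc, div_le_iff₀ (by positivity)]
    rw [← mul_div_assoc, le_div_iff₀ hn0] at h7
    linarith
  have h10 := (Real.le_sqrt' (by positivity)).1 h8
  calc _ = (p / 120 * (n / (m + 2))) ^ 2 := by rw [mul_pow, div_pow (n : ℝ)]
    _ ≤ _ := h10

theorem theorem5p1 (p : ℝ) (hp : 0 < p) :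
    ∃ c : ℝ, 0 < c ∧ ∃ n₀ : ℕ, ∀ n : ℕ, n₀ ≤ n → ∀ k : ℕ, 1 ≤ k →
      ∀ (x₁ : Fin n) (π : HPCProtocol n), π.IsPhase k → π.Solves x₁ k p →
        ∀ b : ℕ, π.CostAtMost b → c * ((n : ℝ) ^ 2 / (k : ℝ) ^ 2 + n) ≤ b := by
  obtain ⟨n₀, hn₀⟩ := Filter.eventually_atTop.1
    (tendsto_guess_error.eventually_lt_const (show 0 < p / 4 by linarith))
  refine ⟨(p / 120) ^ 2 / (4 / p + 2), by positivity, n₀, ?_⟩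
  intro n hn k hk x₁ π hphase hπ b hb
  have hlin := linear_le_cost π x₁ k hk hp hπ b hb ((hn₀ n hn).le.trans (by linarith))
  have hn0 : (0 : ℝ) < n := by exact_mod_cast x₁.pos
  have hk0 : (0 : ℝ) < k := by exact_mod_cast hk
  have hb0 : (0 : ℝ) ≤ b := Nat.cast_nonneg b
  have hpinv : 0 < 4 / p := by positivity
  rw [div_mul_eq_mul_div, div_le_iff₀ (by positivity), mul_add]
  by_cases hkn : (k : ℝ) ^ 2 ≤ p / 4 * n
  · have hquad := quadratic_le_cost π x₁ k hk hp hphase hπ b hb (hn₀ n hn).le hkn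
    nlinarith
  · -- For `k² > (p / 4) n` the linear term dominates.
    have h1 : (n : ℝ) ^ 2 / (k : ℝ) ^ 2 ≤ 4 / p * n := by
      rw [div_le_iff₀ (by positivity)]
      have h2 : 4 / p * n * (p / 4 * n) ≤ 4 / p * n * (k : ℝ) ^ 2 :=
        mul_le_mul_of_nonneg_left (not_le.1 hkn).le (by positivity)
      calc (n : ℝ) ^ 2 = 4 / p * n * (p / 4 * n) := by field_simp
        _ ≤ _ := h2
    have h3 := mul_le_mul_of_nonneg_left h1 (sq_nonneg (p / 120))
    have h4 := mul_le_mul_of_nonneg_left hlin hpinv.le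
    nlinarith
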